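/- \textbf{Setting.} Let $t=(t^{(1)},t^{(2)})$ with $t^{(a)}=(t^{(a)}_1,t^{(a)}_2,\dots)$, and let functions of $t$ be formal power series in $\mathbb C[[t]]$. For $x=(x_1,x_2,\dots)$ put $\xi(x,z)=\sum_{k\ge1}x_kz^k$ and $[z]=(z,z^2/2,z^3/3,\dots)$; put $[z^{-1}]_1=([z^{-1}],0)$, $[z]_2=(0,[z])$, and for $\boldsymbol m=(m_1,m_2)\in\mathbb Z^2$ write $\boldsymbol e=(1,1)$. The integral $\oint_{C_R}\frac{dz}{2\pi i}$ (respectively $\oint_{C_r}\frac{dz}{2\pi i}$) denotes the coefficient of $z^{-1}$ of a formal power series in the time variables with coefficients in $\mathbb C((z^{-1}))$ (respectively $\mathbb C((z))$). Suppose that for every $\boldsymbol m\in\mathbb Z^2$ we are given wave functions and adjoint wave functions of the form $$\Psi_1(\boldsymbol m,t,z)=z^{m_1}e^{\xi(t^{(1)},z)}\Big(1+\sum_{k\ge1}a^{(1)}_k(\boldsymbol m,t)z^{-k}\Big),\qquad \Psi_2(\boldsymbol m,t,z)=z^{m_2}e^{\xi(t^{(2)},z^{-1})}\sum_{k\ge0}a^{(2)}_k(\boldsymbol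 m,t)z^{k},$$ $$\widetilde\Psi_1(\boldsymbol m,t,z)=z^{-m_1+1}e^{-\xi(t^{(1)},z)}\Big(1+\sum_{k\ge1}\widetilde a^{(1)}_k(\boldsymbol m,t)z^{-k}\Big),\qquad \widetilde\Psi_2(\boldsymbol m,t,z)=z^{-m_2+1}e^{-\xi(t^{(2)},z^{-1})}\sum_{k\ge0}\widetilde a^{(2)}_k(\boldsymbol m,t)z^{k},$$ with all coefficients in $\mathbb C[[t]]$, and that they satisfy the bilinear equation of the two-component discrete KP (2dKP) hierarchy $$\oint_{C_R}\frac{dz}{2\pi i z}\Psi_1(\boldsymbol m,t,z)\widetilde\Psi_1(\boldsymbol m',t',z)=\oint_{C_r}\frac{dz}{2\pi i z}\Psi_2(\boldsymbol m,t,z)\widetilde\Psi_2(\boldsymbol m',t',z)$$ for all $\boldsymbol m,\boldsymbol m'\in\mathbb Z^2$ with $m_1-m_2\ge m_1'-m_2'$, as an identity in $\mathbb C[[t,t']]$. \textbf{Proposition (existence of the tau function).} There is a family $\tau_{\boldsymbol m}(t)\in\mathbb C[[t]]$, $\boldsymbol m\in\mathbb Z^2$, of invertible formal power series such that, for all $\boldsymbol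 m\in\mathbb Z^2$, $$\Psi_1(\boldsymbol m,t,z)=z^{m_1}e^{\xi(t^{(1)},z)}\frac{\tau_{\boldsymbol m}(t-[z^{-1}]_1)}{\tau_{\boldsymbol m}(t)},\qquad \widetilde\Psi_1(\boldsymbol m,t,z)=z^{-m_1+1}e^{-\xi(t^{(1)},z)}\frac{\tau_{\boldsymbol m}(t+[z^{-1}]_1)}{\tau_{\boldsymbol m}(t)},$$ $$\Psi_2(\boldsymbol m,t,z)=z^{m_2}e^{\xi(t^{(2)},z^{-1})}\frac{\tau_{\boldsymbol m+\boldsymbol e}(t-[z]_2)}{\tau_{\boldsymbol m}(t)},\qquad \widetilde\Psi_2(\boldsymbol m,t,z)=z^{-m_2+1}e^{-\xi(t^{(2)},z^{-1})}\frac{\tau_{\boldsymbol m-\boldsymbol e}(t+[z]_2)}{\tau_{\boldsymbol m}(t)},$$ and $\tau$ is a tau function of the 2dKP hierarchy: for all $\boldsymbol m,\boldsymbol m'\in\mathbb Z^2$ with $m_1-m_2\ge m_1'-m_2'$, $$\oint_{C_R}\frac{dz}{2\pi i}z^{m_1-m_1'}e^{\xi(t^{(1)}-t^{(1)\prime},z)}\tau_{\boldsymbol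 m}(t-[z^{-1}]_1)\tau_{\boldsymbol m'}(t'+[z^{-1}]_1)=\oint_{C_r}\frac{dz}{2\pi i}z^{m_2-m_2'}e^{\xi(t^{(2)}-t^{(2)\prime},z^{-1})}\tau_{\boldsymbol m+\boldsymbol e}(t-[z]_2)\tau_{\boldsymbol m'-\boldsymbol e}(t'+[z]_2).$$ -/

import Mathlib

noncomputable section

namespace TwoDKP

open MvPowerSeries

/-- Index set of the time variables: `(0, k)` stands for `t^{(1)}_k` and `(1, k)` for `t^{(2)}_k`,
`k = 1, 2, 3, …`. -/
abbrev Time : Type := Fin 2 × ℕ+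

/-- Functions of `t = (t^{(1)}, t^{(2)})`: formal power series over `ℂ` in all time variables. -/
abbrev Fun : Type := MvPowerSeries Time ℂ

/-- The coefficient field of wave functions. For the component `0` the formal variable `w` of
`ℂ((w))` is `w = z⁻¹` (expansions near `z = ∞`, on the large circle `C_R`); for the component `1`
it is `w = z` (expansions near `z = 0`, on the small circle `C_r`). -/
abbrev K : Type := LaurentSeries ℂ

/-- The spectral parameter `z` as an element of `ℂ((z⁻¹))` (component `0`), respectively of
`ℂ((z))` (component `1`). -/
def z (a : Fin 2) : K := if a = 0 then HahnSeries.single (-1) 1 else HahnSeries.single 1 1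

/-- Formal power series in `t` with coefficients in `ℂ((z⁻¹))`, respectively `ℂ((z))`: the ring
in which wave functions live. -/
abbrev Wave : Type := MvPowerSeries Time K

/-- A function of `t`, regarded as an element of `Wave` that does not depend on `z`. -/
def ofFun : Fun →+* Wave := MvPowerSeries.map (HahnSeries.C : ℂ →+* K)

/-- `ξ(t^{(a)}, x) = ∑_{k ≥ 1} t^{(a)}_k x ^ k`, given by its coefficients. -/
def xi (a : Fin 2) (x : K) : Wave := fun d =>
  ∑ᶠ k : ℕ+, if d = Finsupp.single (a, k) 1 then x ^ (k : ℕ) else 0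

/-- `exp F` for a formal power series `F` in `t` without constant term. -/
def expW (F : Wave) : Wave := (PowerSeries.exp K).subst F

/-- `ξ(t^{(1)}, z)` for the component `0`, and `ξ(t^{(2)}, z⁻¹)` for the component `1`. -/
def phase (a : Fin 2) : Wave := if a = 0 then xi 0 (z 0) else xi 1 (z 1)⁻¹

/-- The series `∑_{k ≥ 0} c_k(t) w ^ k`, where `w = z⁻¹` for the component `0` and `w = z` for the
component `1`. -/
def expansion (c : ℕ → Fun) : Wave := fun d =>
  HahnSeries.ofPowerSeries ℤ ℂ (PowerSeries.mk fun k => coeff d (c k))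

/-- The shifted arguments `t + ε [w]_a`, i.e. `t^{(a)}_k + ε w ^ k / k` in the component `a` and
`t^{(b)}_k` in the other one, as power series in `t` and one more variable `w` (indexed by
`none`). -/
def shiftVar (ε : ℂ) (a : Fin 2) (i : Time) : MvPowerSeries (Option Time) ℂ :=
  X (some i) + if i.1 = a then C (ε / ((i.2 : ℕ) : ℂ)) * X none ^ (i.2 : ℕ) else 0

/-- A power series in `t` and `w`, rewritten as a power series in `t` with coefficients in
`ℂ[[w]] ⊆ ℂ((w))`. -/
def collect (G : MvPowerSeries (Option Time) ℂ) : Wave := fun d =>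
  HahnSeries.ofPowerSeries ℤ ℂ (PowerSeries.mk fun n =>
    coeff (d.embDomain Function.Embedding.some + Finsupp.single none n) G)

/-- `f(t + ε [w]_a)`, where `w = z⁻¹` for `a = 0` and `w = z` for `a = 1`; so this is
`f(t + ε [z⁻¹]_1)`, respectively `f(t + ε [z]_2)`. -/
def shift (ε : ℂ) (a : Fin 2) (f : Fun) : Wave := collect (f.subst (shiftVar ε a))

/-- The formal substitution `t ↦ t + ε [w]_a` is legitimate. -/
theorem hasSubst_shiftVar (ε : ℂ) (a : Fin 2) : HasSubst (shiftVar ε a) := by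
  classical
  constructor
  · intro i
    have h : constantCoeff (shiftVar ε a i) = 0 := by
      unfold shiftVar
      split_ifs <;> simp
    rw [h]
    exact IsNilpotent.zero
  · intro d
    refine ((d.support.finite_toSet.preimage (Option.some_injective Time).injOn).union
      ((Set.finite_Iic (d none)).preimage
        (f := fun k : ℕ+ => (k : ℕ)) (PNat.coe_injective.injOn) |>.image
          (fun k => ((a, k) : Time)))).subset ?_
    rintro ⟨b, k⟩ hi
    by_contra hcon
    simp only [Set.mem_union, Set.mem_preimage, Finset.mem_coe, Finsupp.mem_support_iff,
      Set.mem_image, Set.mem_Iic, not_or, not_not, not_exists, not_and] at hcon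
    obtain ⟨h1, h2⟩ := hcon
    apply hi
    unfold shiftVar
    have hX : coeff d (X (some (b, k)) : MvPowerSeries (Option Time) ℂ) = 0 := by
      rw [coeff_X, if_neg]
      rintro rfl
      simp at h1
    rw [map_add, hX, zero_add]
    split_ifs with hb
    · simp only at hb
      rw [coeff_C_mul, coeff_X_pow, if_neg, mul_zero]
      rintro rfl
      exact h2 k (by simp) (by rw [hb])
    · simp

/-- `ξ(t^{(a)}, x)` has no constant term, so that its exponential is legitimate. -/
theorem hasSubst_xi (a : Fin 2) (x : K) : PowerSeries.HasSubst (xi a x) := by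
  apply PowerSeries.HasSubst.of_constantCoeff_zero
  change (∑ᶠ k : ℕ+, if (0 : Time →₀ ℕ) = Finsupp.single (a, k) 1 then x ^ (k : ℕ) else 0) = 0
  apply finsum_eq_zero_of_forall_eq_zero
  intro k
  rw [if_neg]
  intro h
  have := DFunLike.congr_fun h (a, k)
  simp at this

/-- The product `F(t, z) G(t', z)`, a formal power series in two independent sets of times
`t` (indexed by `Sum.inl`) and `t'` (indexed by `Sum.inr`). -/
def outer (F G : Wave) : MvPowerSeries (Time ⊕ Time) K :=
  rename (Function.Embedding.inl : Time ↪ Time ⊕ Time) F *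
    rename (Function.Embedding.inr : Time ↪ Time ⊕ Time) G

/-- `∮ (dz / 2πi) Q(t, t', z)`, i.e. the coefficient of `z⁻¹`, along `C_R` (component `0`),
respectively `C_r` (component `1`). -/
def res (a : Fin 2) (Q : MvPowerSeries (Time ⊕ Time) K) : MvPowerSeries (Time ⊕ Time) ℂ :=
  fun d => HahnSeries.coeff (coeff d Q) (if a = 0 then 1 else -1)

/-- `Ψ₁(m,t,z) = S₁(z^{m₁}) e^{ξ(t^{(1)},z)} = z^{m₁} e^{ξ(t^{(1)},z)} (1 + ∑_{k≥1} a_k(m,t) z^{-k})`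
for some coefficients `a_k`. -/
def IsWave₁ (Ψ : ℤ × ℤ → Wave) : Prop :=
  ∃ c : ℤ × ℤ → ℕ → Fun, (∀ m, c m 0 = 1) ∧
    ∀ m, Ψ m = C (z 0 ^ m.1) * expW (phase 0) * expansion (c m)

/-- `Ψ₂(m,t,z) = S₂(z^{m₂}) e^{ξ(t^{(2)},z⁻¹)} = z^{m₂} e^{ξ(t^{(2)},z⁻¹)} ∑_{k≥0} a_k(m,t) z^k`
for some coefficients `a_k`. -/
def IsWave₂ (Ψ : ℤ × ℤ → Wave) : Prop :=
  ∃ c : ℤ × ℤ → ℕ → Fun,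
    ∀ m, Ψ m = C (z 1 ^ m.2) * expW (phase 1) * expansion (c m)

/-- `Ψ̃₁(m,t,z) = z^{-m₁+1} e^{-ξ(t^{(1)},z)} (1 + ∑_{k≥1} ã_k(m,t) z^{-k})` for some coefficients
`ã_k`. -/
def IsAdjointWave₁ (Ψ : ℤ × ℤ → Wave) : Prop :=
  ∃ c : ℤ × ℤ → ℕ → Fun, (∀ m, c m 0 = 1) ∧
    ∀ m, Ψ m = C (z 0 ^ (-m.1 + 1)) * expW (-phase 0) * expansion (c m)

/-- `Ψ̃₂(m,t,z) = z^{-m₂+1} e^{-ξ(t^{(2)},z⁻¹)} ∑_{k≥0} ã_k(m,t) z^k` for some coefficients `ã_k`. -/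
def IsAdjointWave₂ (Ψ : ℤ × ℤ → Wave) : Prop :=
  ∃ c : ℤ × ℤ → ℕ → Fun,
    ∀ m, Ψ m = C (z 1 ^ (-m.2 + 1)) * expW (-phase 1) * expansion (c m)

/-- The bilinear equation for wave functions:
`∮_{C_R} dz/(2πi z) Ψ₁(m,t,z) Ψ̃₁(m',t',z) = ∮_{C_r} dz/(2πi z) Ψ₂(m,t,z) Ψ̃₂(m',t',z)` for all
`t, t'` and all `m, m'` with `m₁ - m₂ ≥ m₁' - m₂'`. -/
def WaveBilinear (Ψ₁ Ψ₂ Ψt₁ Ψt₂ : ℤ × ℤ → Wave) : Prop :=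
  ∀ m m' : ℤ × ℤ, m'.1 - m'.2 ≤ m.1 - m.2 →
    res 0 (C (z 0)⁻¹ * outer (Ψ₁ m) (Ψt₁ m')) = res 1 (C (z 1)⁻¹ * outer (Ψ₂ m) (Ψt₂ m'))

/-- The bilinear equation for tau functions, for all `t, t'` and all `m, m'` with
`m₁ - m₂ ≥ m₁' - m₂'`:
`∮_{C_R} dz/(2πi) z^{m₁-m₁'} e^{ξ(t^{(1)}-t'^{(1)},z)} τ_m(t-[z⁻¹]_1) τ_{m'}(t'+[z⁻¹]_1)
  = ∮_{C_r} dz/(2πi) z^{m₂-m₂'} e^{ξ(t^{(2)}-t'^{(2)},z⁻¹)} τ_{m+e}(t-[z]_2) τ_{m'-e}(t'+[z]_2)`,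
with `e = (1,1)`. -/
def TauBilinear (τ : ℤ × ℤ → Fun) : Prop :=
  ∀ m m' : ℤ × ℤ, m'.1 - m'.2 ≤ m.1 - m.2 →
    res 0 (C (z 0 ^ (m.1 - m'.1)) * outer (expW (phase 0)) (expW (-phase 0)) *
        outer (shift (-1) 0 (τ m)) (shift 1 0 (τ m'))) =
      res 1 (C (z 1 ^ (m.2 - m'.2)) * outer (expW (phase 1)) (expW (-phase 1)) *
        outer (shift (-1) 1 (τ (m + (1, 1)))) (shift 1 1 (τ (m' - (1, 1)))))

end TwoDKP

end

/-! Strip the exponential and the power of z from the wave functions: what remains are series `P a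
m` (and `Q a m` for the adjoint ones) in t and the local parameter w, which is z⁻¹ at infinity and z
at zero. Put s_0 = 0 and s_1 = (1,1). In the bilinear equation take m' = m + s_a + s_b, which keeps
m₁ - m₂ fixed, and t' = t - [x]_a - [y]_b. The exponentials collapse to the geometric series 1/(1 -
x/w) and 1/(1 - y/w), and the residues become evaluations at w = x and w = y
(`IsBilinear.double_shift`): P_a(m,t,x) Q_a(m',t',x) = P_b(m,t,y) Q_b(m',t',y). Setting one of x, y
to zero, where P_0 and Q_0 equal 1, gives P_a(m,t,w) Q_a(m+s_a,t-[w]_a,w) = 1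
(`IsBilinear.mul_eq_one`); this also proves that P_1 is invertible. Eliminating Q leaves a cocycle
identity for P alone (`IsBilinear.isCocycle`): P_a(m,t,x) P_b(m+s_a,t-[x]_a,y) = P_b(m,t,y)
P_a(m+s_b,t-[y]_b,x).

Such a cocycle is a coboundary up to constants (`IsCocycle.exists_tau`). Apply ∂_y log and then
translate t by [y]_b. By Taylor's formula ∂_y F(t-[y]_b) turns into -∑ y^{k-1} ∂F/∂t^{(b)}_k, so the
coefficients of y^{k-1} say that ∂_i log P_a(m) = ω_i(m+s_a)(t-[w]_a) - ω_i(m)(t) for an explicit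
one-form ω. The same extraction, applied to this equation, shows that ω is closed. The formal
Poincaré lemma yields τ with d log τ_m = ω(m), and P_a(m) is a constant times
τ_{m+s_a}(t-[w]_a)/τ_m(t). The constants are 1 for a = 0; for a = 1 they are absorbed by rescaling τ
along the lines m + ℤ(1,1). The inverse relation then gives Q, and multiplying the bilinear equation
by τ_m(t) τ_{m'}(t') gives the one for τ.

The formal rules behind this (chain rule, Taylor's formula, evaluation at w = x) are reduced to
polynomials or variables: each coefficient of the output depends on finitely many coefficients of
the input. -/

noncomputable section

namespace TwoDKP

open MvPowerSeries

/-! ### Maps of power series determined by finitely many coefficients -/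

section FiniteDetermination

variable {σ τ υ R S M : Type*} [CommRing R] [CommRing S] [AddCommGroup M]

/-- The value of `ℓ` depends on finitely many coefficients only (for additive `ℓ`). -/
def FinDet (ℓ : MvPowerSeries σ R → M) : Prop :=
  ∃ T : Finset (σ →₀ ℕ), ∀ F, (∀ d ∈ T, coeff d F = 0) → ℓ F = 0

/-- Each coefficient of `Φ F` depends on finitely many coefficients of `F`. -/
def CoeffFin (Φ : MvPowerSeries σ R → MvPowerSeries τ S) : Prop :=
  ∀ e, FinDet fun F => coeff e (Φ F)

theorem FinDet.congr {ℓ ℓ' : MvPowerSeries σ R → M} (h : FinDet ℓ) (he : ∀ F, ℓ' F = ℓ F) :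
    FinDet ℓ' := (funext he : ℓ' = ℓ) ▸ h

theorem FinDet.comp {ℓ : MvPowerSeries τ S → M} (hℓ : FinDet ℓ)
    {Φ : MvPowerSeries σ R → MvPowerSeries τ S} (hΦ : CoeffFin Φ) :
    FinDet fun F => ℓ (Φ F) := by
  classical
  obtain ⟨T, hT⟩ := hℓ
  choose U hU using hΦ
  refine ⟨T.biUnion U, fun F hF => hT _ fun d hd => hU d F fun e he => hF e ?_⟩
  exact Finset.mem_biUnion.2 ⟨d, hd, he⟩

theorem CoeffFin.comp {Ψ : MvPowerSeries τ S → MvPowerSeries υ S} (hΨ : CoeffFin Ψ)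
    {Φ : MvPowerSeries σ R → MvPowerSeries τ S} (hΦ : CoeffFin Φ) :
    CoeffFin fun F => Ψ (Φ F) := fun e => (hΨ e).comp hΦ

/-- A substitute for continuity and density of polynomials that needs no topology. -/
theorem FinDet.eq_of_polynomial {ℓ₁ ℓ₂ : MvPowerSeries σ R →+ M} (h₁ : FinDet ℓ₁)
    (h₂ : FinDet ℓ₂) (h : ∀ p : MvPolynomial σ R, ℓ₁ p = ℓ₂ p) (F : MvPowerSeries σ R) :
    ℓ₁ F = ℓ₂ F := by
  classical
  obtain ⟨T₁, hT₁⟩ := h₁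
  obtain ⟨T₂, hT₂⟩ := h₂
  -- The truncation of `F` to the finitely many monomials that either functional reads.
  let p : MvPolynomial σ R := ∑ d ∈ T₁ ∪ T₂, MvPolynomial.monomial d (coeff d F)
  have hp : ∀ d ∈ T₁ ∪ T₂, coeff d (F - (p : MvPowerSeries σ R)) = 0 := by
    intro d hd
    rw [map_sub, MvPolynomial.coeff_coe, MvPolynomial.coeff_sum]
    simp only [MvPolynomial.coeff_monomial]
    rw [Finset.sum_ite_eq' (T₁ ∪ T₂) d, if_pos hd, sub_self]
  have e₁ := hT₁ _ fun d hd => hp d (Finset.mem_union_left _ hd)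
  have e₂ := hT₂ _ fun d hd => hp d (Finset.mem_union_right _ hd)
  rw [map_sub, sub_eq_zero] at e₁ e₂
  rw [e₁, e₂, h]

theorem CoeffFin.eq_of_polynomial {Φ₁ Φ₂ : MvPowerSeries σ R →+ MvPowerSeries τ S}
    (h₁ : CoeffFin Φ₁) (h₂ : CoeffFin Φ₂) (h : ∀ p : MvPolynomial σ R, Φ₁ p = Φ₂ p)
    (F : MvPowerSeries σ R) : Φ₁ F = Φ₂ F := by
  ext e
  exact FinDet.eq_of_polynomial (ℓ₁ := (coeff e).toAddMonoidHom.comp Φ₁)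
    (ℓ₂ := (coeff e).toAddMonoidHom.comp Φ₂) (h₁ e) (h₂ e)
    (fun p => congrArg (coeff e) (h p)) F

/-- Two finitely determined derivations along a ring homomorphism agree if they agree on the
constants and on the variables. -/
theorem CoeffFin.eq_of_leibniz (φ : MvPowerSeries σ R → MvPowerSeries τ S)
    {D₁ D₂ : MvPowerSeries σ R →+ MvPowerSeries τ S} (h₁ : CoeffFin D₁) (h₂ : CoeffFin D₂)
    (l₁ : ∀ F G, D₁ (F * G) = φ F * D₁ G + φ G * D₁ F)
    (l₂ : ∀ F G, D₂ (F * G) = φ F * D₂ G + φ G * D₂ F)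
    (hC : ∀ r, D₁ (C r) = D₂ (C r)) (hX : ∀ i, D₁ (X i) = D₂ (X i)) (F : MvPowerSeries σ R) :
    D₁ F = D₂ F := by
  refine CoeffFin.eq_of_polynomial h₁ h₂ (fun p => ?_) F
  induction p using MvPolynomial.induction_on with
  | C r => simpa using hC r
  | add p q hp hq => simp [hp, hq]
  | mul_X p i hp => simp [l₁, l₂, hp, hX]

theorem CoeffFin.mul_const {Φ : MvPowerSeries σ R → MvPowerSeries τ S} (hΦ : CoeffFin Φ)
    (G : MvPowerSeries τ S) : CoeffFin fun F => Φ F * G := by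
  classical
  intro e
  choose U hU using hΦ
  refine ⟨((Finset.HasAntidiagonal.antidiagonal e).image Prod.fst).biUnion U, fun F hF => ?_⟩
  simp only [coeff_mul]
  refine Finset.sum_eq_zero fun p hp => ?_
  rw [show coeff p.1 (Φ F) = 0 from hU p.1 F fun d hd => hF d ?_, zero_mul]
  exact Finset.mem_biUnion.2 ⟨p.1, Finset.mem_image_of_mem _ hp, hd⟩

theorem coeffFin_pderiv (i : σ) : CoeffFin (pderiv R i) := fun e =>
  ⟨{e + Finsupp.single i 1}, fun F hF => by
    simp only [coeff_pderiv]
    rw [hF _ (Finset.mem_singleton_self _), zero_mul]⟩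

theorem coeffFin_subst [Algebra R S] {a : σ → MvPowerSeries τ S} (ha : HasSubst a) :
    CoeffFin (subst a : MvPowerSeries σ R → MvPowerSeries τ S) := by
  intro e
  -- The series with all coefficients 1 gives a finite set of exponents that serves every `F` at
  -- once.
  have hfin := coeff_subst_finite ha (fun _ => (1 : R)) e
  refine ⟨hfin.toFinset, fun F hF => ?_⟩
  simp only [coeff_subst ha]
  refine finsum_eq_zero_of_forall_eq_zero fun d => ?_
  by_cases hd : d ∈ hfin.toFinset
  · rw [hF d hd, zero_smul]
  · have h1 : ((1 : R) • coeff e (d.prod fun s n => a s ^ n)) = 0 := by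
      by_contra hne
      exact hd (hfin.mem_toFinset.2 hne)
    rw [one_smul] at h1
    rw [h1, smul_zero]

end FiniteDetermination

/-! ### Chain rule for substitution -/

section ChainRule

variable {σ τ R : Type*} [CommRing R]

/-- Chain rule, when only one of the substituted series depends on the variable. -/
theorem pderiv_subst [DecidableEq σ] {a : σ → MvPowerSeries τ R} (ha : HasSubst a) (s : σ)
    (t : τ) (g : MvPowerSeries τ R) (h : ∀ i, pderiv R t (a i) = if i = s then g else 0)
    (F : MvPowerSeries σ R) :
    pderiv R t (subst a F) = subst a (pderiv R s F) * g := by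
  let φ : MvPowerSeries σ R →+* MvPowerSeries τ R := (substAlgHom (R := R) ha).toRingHom
  have hφ : ∀ F, φ F = subst a F := fun F => substAlgHom_apply ha F
  let D₁ : MvPowerSeries σ R →+ MvPowerSeries τ R :=
    (pderiv R t).toLinearMap.toAddMonoidHom.comp φ.toAddMonoidHom
  let D₂ : MvPowerSeries σ R →+ MvPowerSeries τ R :=
    (AddMonoidHom.mulRight g).comp
      (φ.toAddMonoidHom.comp (pderiv R s).toLinearMap.toAddMonoidHom)
  have e₁ : ∀ F, D₁ F = pderiv R t (subst a F) := fun F => by rw [← hφ]; rfl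
  have e₂ : ∀ F, D₂ F = subst a (pderiv R s F) * g := fun F => by rw [← hφ]; rfl
  rw [← e₁, ← e₂]
  refine CoeffFin.eq_of_leibniz (subst a) ?_ ?_ ?_ ?_ ?_ ?_ F
  · have : (D₁ : MvPowerSeries σ R → MvPowerSeries τ R) = fun F => pderiv R t (subst a F) :=
      funext e₁
    rw [this]
    exact (coeffFin_pderiv t).comp (coeffFin_subst ha)
  · have : (D₂ : MvPowerSeries σ R → MvPowerSeries τ R) =
      fun F => subst a (pderiv R s F) * g := funext e₂
    rw [this]
    exact ((coeffFin_subst ha).comp (coeffFin_pderiv s)).mul_const g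
  · intro F G
    simp [e₁, subst_mul ha, Derivation.leibniz]
  · intro F G
    simp only [e₂, Derivation.leibniz, subst_add ha, subst_mul ha, smul_eq_mul]
    ring
  · intro r
    rw [e₁, e₂, subst_C, pderiv_C, pderiv_C, ← map_zero (C (R := R) (σ := σ)), subst_C, map_zero,
      zero_mul]
  · intro i
    rw [e₁, e₂, subst_X ha, h, pderiv_X]
    by_cases hi : i = s
    · subst hi
      rw [if_pos rfl, Pi.single_eq_same, ← map_one (C (R := R) (σ := σ)), subst_C, map_one,
        one_mul]
    · rw [if_neg hi, Pi.single_eq_of_ne hi, ← map_zero (C (R := R) (σ := σ)), subst_C, map_zero,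
        zero_mul]

end ChainRule

/-! ### Substitutions and inverses -/

section Substitution

variable {σ τ : Type*}

theorem hasSubst_option {a : σ → MvPowerSeries τ ℂ} (ha : HasSubst a) {b : MvPowerSeries τ ℂ}
    (hb : constantCoeff b = 0) :
    HasSubst (fun o : Option σ => o.elim b a) := by
  constructor
  · rintro (_ | i)
    · simp [hb]
    · exact ha.const_coeff i
  · intro d
    refine (((ha.coeff_zero d).image some).union (Set.finite_singleton none)).subset ?_
    rintro (_ | i) hi
    · exact Or.inr rfl
    · exact Or.inl ⟨i, hi, rfl⟩

theorem hasSubst_X_comp {f : σ → τ} (hf : Function.Injective f) :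
    HasSubst (fun i => (X (f i) : MvPowerSeries τ ℂ)) := by
  classical
  constructor
  · simp
  · intro d
    refine ((d.support.finite_toSet).preimage hf.injOn).subset fun i hi => ?_
    have : d = Finsupp.single (f i) 1 := by
      by_contra h
      exact hi (by rw [coeff_X, if_neg h])
    simp [this]

theorem constantCoeff_subst_of_zero {a : σ → MvPowerSeries τ ℂ} (ha : HasSubst a)
    (h0 : ∀ i, constantCoeff (a i) = 0) (F : MvPowerSeries σ ℂ) :
    constantCoeff (subst a F) = constantCoeff F := by
  have h := constantCoeff_subst_eq_zero ha h0 (f := F - C (constantCoeff F)) (by simp)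
  rwa [subst_sub ha, subst_C, map_sub, constantCoeff_C, sub_eq_zero] at h

theorem subst_one {a : σ → MvPowerSeries τ ℂ} :
    subst a (1 : MvPowerSeries σ ℂ) = 1 := by
  rw [← map_one (C (R := ℂ) (σ := σ)), subst_C, map_one]

theorem subst_zero {a : σ → MvPowerSeries τ ℂ} :
    subst a (0 : MvPowerSeries σ ℂ) = 0 := by
  rw [← map_zero (C (R := ℂ) (σ := σ)), subst_C, map_zero]

theorem subst_inv {a : σ → MvPowerSeries τ ℂ} (ha : HasSubst a)
    (h0 : ∀ i, constantCoeff (a i) = 0) {F : MvPowerSeries σ ℂ} (hF : constantCoeff F ≠ 0) :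
    subst a F⁻¹ = (subst a F)⁻¹ := by
  rw [MvPowerSeries.eq_inv_iff_mul_eq_one (by rwa [constantCoeff_subst_of_zero ha h0]),
    ← subst_mul ha, MvPowerSeries.inv_mul_cancel _ hF, subst_one]

end Substitution

/-! ### Logarithmic derivatives -/

section Dlog

variable {σ τ : Type*}

/-- The logarithmic derivative. -/
def dlog (i : σ) (F : MvPowerSeries σ ℂ) : MvPowerSeries σ ℂ := pderiv ℂ i F * F⁻¹

theorem dlog_mul (i : σ) {F G : MvPowerSeries σ ℂ} (hF : constantCoeff F ≠ 0)
    (hG : constantCoeff G ≠ 0) : dlog i (F * G) = dlog i F + dlog i G := by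
  have h1 := MvPowerSeries.mul_inv_cancel F hF
  have h2 := MvPowerSeries.mul_inv_cancel G hG
  simp only [dlog, Derivation.leibniz, smul_eq_mul, MvPowerSeries.mul_inv_rev]
  linear_combination (pderiv ℂ i G * G⁻¹) * h1 + (pderiv ℂ i F * F⁻¹) * h2

theorem dlog_inv (i : σ) {F : MvPowerSeries σ ℂ} (hF : constantCoeff F ≠ 0) :
    dlog i F⁻¹ = -dlog i F := by
  have h := dlog_mul i hF (G := F⁻¹) (by simpa using hF)
  rw [MvPowerSeries.mul_inv_cancel F hF] at h
  have h1 : dlog i (1 : MvPowerSeries σ ℂ) = 0 := by simp [dlog]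
  rw [h1] at h
  exact (neg_eq_of_add_eq_zero_right h.symm).symm

theorem pderiv_comm (i j : σ) (F : MvPowerSeries σ ℂ) :
    pderiv ℂ i (pderiv ℂ j F) = pderiv ℂ j (pderiv ℂ i F) := by
  classical
  ext d
  simp only [coeff_pderiv, Finsupp.add_apply]
  rw [add_right_comm]
  by_cases h : i = j
  · subst h; rfl
  · rw [Finsupp.single_eq_of_ne h, Finsupp.single_eq_of_ne (Ne.symm h)]
    simp only [add_zero]
    ring

/-- Equality of mixed second derivatives of log F, without a logarithm. -/
theorem pderiv_dlog_comm (i j : σ) (F : MvPowerSeries σ ℂ) :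
    pderiv ℂ i (dlog j F) = pderiv ℂ j (dlog i F) := by
  simp only [dlog, Derivation.leibniz, smul_eq_mul, pderiv_inv', pderiv_comm i j F]
  ring

theorem dlog_subst [DecidableEq σ] {a : σ → MvPowerSeries τ ℂ} (ha : HasSubst a)
    (h0 : ∀ i, constantCoeff (a i) = 0) (s : σ) (t : τ)
    (h : ∀ i, pderiv ℂ t (a i) = if i = s then 1 else 0) {F : MvPowerSeries σ ℂ}
    (hF : constantCoeff F ≠ 0) :
    dlog t (subst a F) = subst a (dlog s F) := by
  rw [dlog, dlog, pderiv_subst ha s t 1 h, mul_one, subst_mul ha, subst_inv ha h0 hF]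

end Dlog

/-! ### Translations t ↦ t + ε[w] -/

section Shift

variable {τ : Type*}

/-- `X i + ε w ^ k / k` if `κ i = some k`, and `X i` if `κ i = none`, where `w = X none`. -/
def gshift (ε : ℂ) (κ : τ → Option ℕ+) (i : τ) : MvPowerSeries (Option τ) ℂ :=
  X (some i) + (κ i).elim 0 fun k => C (ε / ((k : ℕ) : ℂ)) * X none ^ (k : ℕ)

/-- At most one variable is shifted by a multiple of any given power of `w`. -/
def InjLabel (κ : τ → Option ℕ+) : Prop := ∀ i j k, κ i = some k → κ j = some k → i = j

theorem constantCoeff_gshift (ε : ℂ) (κ : τ → Option ℕ+) (i : τ) :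
    constantCoeff (gshift ε κ i) = 0 := by
  unfold gshift
  rcases κ i with _ | k <;> simp

/-- A given monomial can contain w^k only for boundedly many k, and injectivity of the labels turns
this into finitely many variables. -/
theorem hasSubst_gshift (ε : ℂ) {κ : τ → Option ℕ+} (hκ : InjLabel κ) :
    HasSubst (gshift ε κ) := by
  classical
  constructor
  · intro i
    rw [constantCoeff_gshift]
    exact IsNilpotent.zero
  · intro d
    have hfin : {i | ∃ k, κ i = some k ∧ (k : ℕ) ≤ d none}.Finite := by
      refine Set.Finite.of_finite_image (f := fun i => ((κ i).elim 0 fun k => (k : ℕ)))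
        ((Set.finite_Iic (d none)).subset ?_) ?_
      · rintro _ ⟨i, ⟨k, hk, hkd⟩, rfl⟩
        simpa [hk] using hkd
      · rintro i ⟨k, hk, -⟩ j ⟨l, hl, -⟩ hij
        simp only [hk, hl, Option.elim_some, PNat.coe_inj] at hij
        exact hκ i j k hk (hij ▸ hl)
    refine ((d.support.finite_toSet.preimage (Option.some_injective τ).injOn).union hfin).subset ?_
    intro i hi
    by_contra hcon
    simp only [Set.mem_union, Set.mem_preimage, Finset.mem_coe, Finsupp.mem_support_iff,
      not_or, not_not, Set.mem_ofPred_eq, not_exists, not_and] at hcon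
    obtain ⟨h1, h2⟩ := hcon
    apply hi
    rw [gshift, map_add, coeff_X, if_neg (by rintro rfl; simp at h1), zero_add]
    rcases hk : κ i with _ | k
    · simp
    · rw [Option.elim_some, coeff_C_mul, coeff_X_pow, if_neg, mul_zero]
      rintro rfl
      exact h2 k hk (by simp)

/-- `F(t + ε[w])`. -/
def sh (ε : ℂ) (κ : τ → Option ℕ+) (F : MvPowerSeries τ ℂ) : MvPowerSeries (Option τ) ℂ :=
  subst (gshift ε κ) F

/-- `F` as a series not depending on `w`. -/
def inc (F : MvPowerSeries τ ℂ) : MvPowerSeries (Option τ) ℂ := subst (fun i => X (some i)) F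

/-- `F(t + ε[w], w)`. -/
def shA (ε : ℂ) (κ : τ → Option ℕ+) (F : MvPowerSeries (Option τ) ℂ) :
    MvPowerSeries (Option τ) ℂ :=
  subst (fun o : Option τ => o.elim (X none) (gshift ε κ)) F

theorem hasSubst_inc : HasSubst (fun i : τ => (X (some i) : MvPowerSeries (Option τ) ℂ)) :=
  hasSubst_X_comp (Option.some_injective τ)

theorem hasSubst_shA (ε : ℂ) {κ : τ → Option ℕ+} (hκ : InjLabel κ) :
    HasSubst (fun o : Option τ => o.elim (X none) (gshift ε κ)) :=
  hasSubst_option (hasSubst_gshift ε hκ) (by simp)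

theorem constantCoeff_shA_var (ε : ℂ) (κ : τ → Option ℕ+) (o : Option τ) :
    constantCoeff (o.elim (X none) (gshift ε κ)) = 0 := by
  rcases o with _ | i
  · simp
  · exact constantCoeff_gshift ε κ i

theorem subst_shA_gshift (ε δ : ℂ) {κ : τ → Option ℕ+} (hκ : InjLabel κ) (i : τ) :
    subst (fun o : Option τ => o.elim (X none) (gshift ε κ)) (gshift δ κ i)
      = gshift (ε + δ) κ i := by
  have h := hasSubst_shA ε hκ
  rw [gshift, gshift, subst_add h, subst_X h]
  rcases hk : κ i with _ | k
  · simp [subst_zero, gshift, hk]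
  · simp only [Option.elim_some, subst_mul h, subst_C, subst_pow h, subst_X h, gshift, hk,
      Option.elim_none, add_div, map_add]
    ring

theorem gshift_zero (κ : τ → Option ℕ+) (i : τ) : gshift 0 κ i = X (some i) := by
  rw [gshift]
  rcases κ i with _ | k <;> simp

theorem shA_sh (ε δ : ℂ) {κ : τ → Option ℕ+} (hκ : InjLabel κ) (F : MvPowerSeries τ ℂ) :
    shA ε κ (sh δ κ F) = sh (ε + δ) κ F := by
  rw [shA, sh, subst_comp_subst_apply (hasSubst_gshift δ hκ) (hasSubst_shA ε hκ), sh]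
  simp_rw [subst_shA_gshift ε δ hκ]

theorem sh_zero (κ : τ → Option ℕ+) (F : MvPowerSeries τ ℂ) : sh 0 κ F = inc F := by
  rw [sh, inc]
  congr 1
  exact funext (gshift_zero κ)

theorem shA_inc (ε : ℂ) {κ : τ → Option ℕ+} (hκ : InjLabel κ) (F : MvPowerSeries τ ℂ) :
    shA ε κ (inc F) = sh ε κ F := by
  rw [← sh_zero κ, shA_sh ε 0 hκ, add_zero]

theorem shA_shA (ε δ : ℂ) {κ : τ → Option ℕ+} (hκ : InjLabel κ)
    (F : MvPowerSeries (Option τ) ℂ) : shA ε κ (shA δ κ F) = shA (ε + δ) κ F := by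
  rw [shA, shA, subst_comp_subst_apply (hasSubst_shA δ hκ) (hasSubst_shA ε hκ), shA]
  congr 1
  funext o
  rcases o with _ | i
  · exact subst_X (hasSubst_shA ε hκ) none
  · exact subst_shA_gshift ε δ hκ i

theorem shA_zero (κ : τ → Option ℕ+) (F : MvPowerSeries (Option τ) ℂ) : shA 0 κ F = F := by
  have : (fun o : Option τ => o.elim (X none) (gshift 0 κ)) =
      (X : Option τ → MvPowerSeries (Option τ) ℂ) := by
    funext o
    rcases o with _ | i
    · rfl
    · exact gshift_zero κ i
  rw [shA, this, subst_self, id]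

theorem shA_mul (ε : ℂ) {κ : τ → Option ℕ+} (hκ : InjLabel κ)
    (F G : MvPowerSeries (Option τ) ℂ) : shA ε κ (F * G) = shA ε κ F * shA ε κ G :=
  subst_mul (hasSubst_shA ε hκ) F G

theorem pderiv_some_gshift [DecidableEq τ] (ε : ℂ) (κ : τ → Option ℕ+) (i j : τ) :
    pderiv ℂ (some i) (gshift ε κ j) = if j = i then 1 else 0 := by
  classical
  rw [gshift, map_add, pderiv_X]
  have : pderiv ℂ (some i) ((κ j).elim 0 fun k => C (ε / ((k : ℕ) : ℂ)) *
      (X none : MvPowerSeries (Option τ) ℂ) ^ (k : ℕ)) = 0 := by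
    rcases κ j with _ | k
    · simp
    · simp [Derivation.leibniz, pderiv_X_of_ne]
  rw [this, add_zero]
  by_cases h : j = i
  · subst h; simp
  · rw [if_neg h, Pi.single_eq_of_ne (by simpa using h)]

theorem pderiv_some_shA (ε : ℂ) {κ : τ → Option ℕ+} (hκ : InjLabel κ) (i : τ)
    (F : MvPowerSeries (Option τ) ℂ) :
    pderiv ℂ (some i) (shA ε κ F) = shA ε κ (pderiv ℂ (some i) F) := by
  classical
  rw [shA, pderiv_subst (hasSubst_shA ε hκ) (some i) (some i) 1, mul_one, shA]
  rintro (_ | j)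
  · simp [pderiv_X_of_ne]
  · simpa using pderiv_some_gshift ε κ i j

theorem pderiv_none_inc (F : MvPowerSeries τ ℂ) : pderiv ℂ none (inc F) = 0 := by
  classical
  -- `pderiv_subst` asks for some variable `s` even when the derivative `g` is zero, hence the
  -- separate case of no variables.
  rcases isEmpty_or_nonempty τ with hτ | ⟨⟨i⟩⟩
  · have : F = C (constantCoeff F) := by
      ext d
      rw [Subsingleton.elim d 0]
      simp
    rw [this, inc, subst_C, pderiv_C]
  · rw [inc, pderiv_subst hasSubst_inc i none 0, mul_zero]
    intro j
    rw [pderiv_X_of_ne (by simp), ite_self]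

theorem inc_mul (F G : MvPowerSeries τ ℂ) : inc (F * G) = inc F * inc G :=
  subst_mul hasSubst_inc F G

theorem constantCoeff_inc (F : MvPowerSeries τ ℂ) : constantCoeff (inc F) = constantCoeff F :=
  constantCoeff_subst_of_zero hasSubst_inc (by simp) F

theorem constantCoeff_sh (ε : ℂ) {κ : τ → Option ℕ+} (hκ : InjLabel κ) (F : MvPowerSeries τ ℂ) :
    constantCoeff (sh ε κ F) = constantCoeff F :=
  constantCoeff_subst_of_zero (hasSubst_gshift ε hκ) (constantCoeff_gshift ε κ) F

theorem shA_inv (ε : ℂ) {κ : τ → Option ℕ+} (hκ : InjLabel κ) {F : MvPowerSeries (Option τ) ℂ}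
    (hF : constantCoeff F ≠ 0) : shA ε κ F⁻¹ = (shA ε κ F)⁻¹ :=
  subst_inv (hasSubst_shA ε hκ) (constantCoeff_shA_var ε κ) hF

theorem inc_inv {F : MvPowerSeries τ ℂ} (hF : constantCoeff F ≠ 0) : inc F⁻¹ = (inc F)⁻¹ :=
  subst_inv hasSubst_inc (by simp) hF

theorem dlog_some_sh (ε : ℂ) {κ : τ → Option ℕ+} (hκ : InjLabel κ) (i : τ)
    {F : MvPowerSeries τ ℂ} (hF : constantCoeff F ≠ 0) :
    dlog (some i) (sh ε κ F) = sh ε κ (dlog i F) := by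
  classical
  exact dlog_subst (hasSubst_gshift ε hκ) (constantCoeff_gshift ε κ) i (some i)
    (pderiv_some_gshift ε κ i) hF

end Shift

/-! ### Coefficients in w and Taylor's formula -/

section WCoeff

variable {τ : Type*}

/-- The coefficient of `w ^ n`, where `w = X none`. -/
def wCoeff (n : ℕ) (F : MvPowerSeries (Option τ) ℂ) : MvPowerSeries τ ℂ :=
  PowerSeries.coeff n (optionEquivLeft τ ℂ F)

theorem coeff_wCoeff (n : ℕ) (F : MvPowerSeries (Option τ) ℂ) (d : τ →₀ ℕ) :
    coeff d (wCoeff n F) = coeff (d.optionElim n) F :=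
  coeff_coeff_optionEquivLeft F n d

theorem wCoeff_ext {F G : MvPowerSeries (Option τ) ℂ} (h : ∀ n, wCoeff n F = wCoeff n G) :
    F = G :=
  (optionEquivLeft τ ℂ).injective (PowerSeries.ext h)

theorem wCoeff_add (n : ℕ) (F G : MvPowerSeries (Option τ) ℂ) :
    wCoeff n (F + G) = wCoeff n F + wCoeff n G := by simp [wCoeff]

theorem coeffFin_wCoeff (n : ℕ) : CoeffFin (wCoeff (τ := τ) n) := fun e =>
  ⟨{e.optionElim n}, fun F hF => by
    simp only [coeff_wCoeff]
    exact hF _ (Finset.mem_singleton_self _)⟩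

theorem optionEquivLeft_inc (F : MvPowerSeries τ ℂ) :
    optionEquivLeft τ ℂ (inc F) = PowerSeries.C F := by
  let ψ : MvPowerSeries τ ℂ →+* PowerSeries (MvPowerSeries τ ℂ) :=
    (optionEquivLeft τ ℂ).toAlgHom.toRingHom.comp (substAlgHom (R := ℂ) hasSubst_inc).toRingHom
  have hψ : ∀ F, ψ F = optionEquivLeft τ ℂ (inc F) := fun F => by
    rw [inc, ← substAlgHom_apply hasSubst_inc]; rfl
  have hp : ψ.comp (MvPolynomial.coeToMvPowerSeries.ringHom (R := ℂ) (σ := τ)) =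
      PowerSeries.C.comp MvPolynomial.coeToMvPowerSeries.ringHom := by
    refine MvPolynomial.ringHom_ext (fun r => ?_) (fun i => ?_)
    · simp [hψ, inc]
    · simp [hψ, inc, subst_X hasSubst_inc]
  rw [← hψ]
  ext n e
  refine FinDet.eq_of_polynomial
    (ℓ₁ := (coeff e).toAddMonoidHom.comp ((PowerSeries.coeff n).toAddMonoidHom.comp
      ψ.toAddMonoidHom))
    (ℓ₂ := (coeff e).toAddMonoidHom.comp ((PowerSeries.coeff n).toAddMonoidHom.comp
      PowerSeries.C.toAddMonoidHom)) ?_ ?_ ?_ F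
  · exact (((coeffFin_wCoeff n).comp (coeffFin_subst (R := ℂ) hasSubst_inc)) e).congr
      fun F => congrArg (fun q => coeff e (PowerSeries.coeff n q)) (hψ F)
  · refine ⟨{e}, fun F hF => ?_⟩
    have := hF e (Finset.mem_singleton_self e)
    simp only [AddMonoidHom.coe_comp, Function.comp]
    change coeff e (PowerSeries.coeff n (PowerSeries.C F)) = 0
    rw [PowerSeries.coeff_C]
    split_ifs <;> simp [this]
  · intro p
    exact congrArg (fun q => coeff e (PowerSeries.coeff n q)) (DFunLike.congr_fun hp p)

theorem wCoeff_inc_mul (n : ℕ) (F : MvPowerSeries τ ℂ) (G : MvPowerSeries (Option τ) ℂ) :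
    wCoeff n (inc F * G) = F * wCoeff n G := by
  simp [wCoeff, optionEquivLeft_inc]

theorem wCoeff_pderiv_some (n : ℕ) (i : τ) (F : MvPowerSeries (Option τ) ℂ) :
    wCoeff n (pderiv ℂ (some i) F) = pderiv ℂ i (wCoeff n F) := by
  classical
  ext d
  simp only [coeff_wCoeff, coeff_pderiv]
  have : d.optionElim n + Finsupp.single (some i) 1 =
      (d + Finsupp.single i 1).optionElim n := by
    ext (_ | j) <;> simp [Finsupp.single_apply]
  rw [this, Finsupp.optionElim_apply_some]

/-- Taylor's formula: the vector field `∂_w` in the coordinates `(t + ε[w], w)`. -/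
theorem wCoeff_shA_pderiv_sh (ε : ℂ) {κ : τ → Option ℕ+} (hκ : InjLabel κ) (n : ℕ) (i : τ)
    (hi : κ i = some n.succPNat) (F : MvPowerSeries τ ℂ) :
    wCoeff n (shA ε κ (pderiv ℂ none (sh (-ε) κ F))) = -C ε * pderiv ℂ i F := by
  classical
  let D₁ : MvPowerSeries τ ℂ →+ MvPowerSeries τ ℂ :=
    AddMonoidHom.mk' (fun F => wCoeff n (shA ε κ (pderiv ℂ none (sh (-ε) κ F)))) fun F G => by
      rw [sh, subst_add (hasSubst_gshift _ hκ), map_add, shA, subst_add (hasSubst_shA _ hκ),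
        wCoeff_add]
      rfl
  let D₂ : MvPowerSeries τ ℂ →+ MvPowerSeries τ ℂ :=
    AddMonoidHom.mk' (fun F => pderiv ℂ i F * -C ε) fun F G => by rw [map_add, add_mul]
  have key : D₁ F = D₂ F := by
    -- Both sides are derivations along the identity: after differentiating a product, the
    -- undifferentiated factor is translated back to a series free of w and passes through `wCoeff`.
    refine CoeffFin.eq_of_leibniz (fun F => F) ?_ ?_ ?_ ?_ ?_ ?_ F
    · exact (coeffFin_wCoeff n).comp ((coeffFin_subst (hasSubst_shA ε hκ)).comp
        ((coeffFin_pderiv none).comp (coeffFin_subst (hasSubst_gshift (-ε) hκ))))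
    · exact (coeffFin_pderiv i).mul_const _
    · intro F G
      have e : ∀ F, shA ε κ (sh (-ε) κ F) = inc F := fun F => by
        rw [shA_sh _ _ hκ, add_neg_cancel, sh_zero]
      simp only [D₁, AddMonoidHom.mk'_apply]
      rw [sh, subst_mul (hasSubst_gshift _ hκ), Derivation.leibniz, shA,
        subst_add (hasSubst_shA _ hκ), smul_eq_mul, smul_eq_mul, subst_mul (hasSubst_shA _ hκ),
        subst_mul (hasSubst_shA _ hκ), wCoeff_add]
      have eF := e F
      have eG := e G
      simp only [sh, shA] at eF eG
      rw [eF, eG, wCoeff_inc_mul, wCoeff_inc_mul]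
      rfl
    · intro F G
      simp only [D₂, AddMonoidHom.mk'_apply, Derivation.leibniz, smul_eq_mul]
      ring
    · intro r
      simp [D₁, D₂, sh, shA, subst_zero, wCoeff]
    · intro j
      simp only [D₁, D₂, AddMonoidHom.mk'_apply]
      rw [sh, subst_X (hasSubst_gshift _ hκ), gshift, map_add, pderiv_X_of_ne (by simp), zero_add]
      rcases hj : κ j with _ | k
      · have hne : j ≠ i := by rintro rfl; rw [hi] at hj; cases hj
        simp [shA, subst_zero, wCoeff, pderiv_X_of_ne hne]
      -- The denominator in `[w]` cancels the exponent, so a variable with label k contributes -ε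
      -- w^{k-1}; only k = n + 1 survives in degree n.
      · have hk : ((k : ℕ) : ℂ) ≠ 0 := by exact_mod_cast k.ne_zero
        have : pderiv ℂ none (C (-ε / ((k : ℕ) : ℂ)) *
            (X none : MvPowerSeries (Option τ) ℂ) ^ (k : ℕ)) =
            C (-ε) * X none ^ ((k : ℕ) - 1) := by
          rw [Derivation.leibniz, pderiv_C, pderiv_pow, pderiv_X_self, smul_zero, add_zero,
            smul_eq_mul, mul_one, ← mul_assoc]
          congr 1
          rw [← map_natCast (C (R := ℂ) (σ := Option τ)), ← map_mul]
          congr 1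
          field_simp
        rw [Option.elim_some, this, shA, subst_mul (hasSubst_shA _ hκ), subst_C,
          subst_pow (hasSubst_shA _ hκ), subst_X (hasSubst_shA _ hκ), Option.elim_none]
        have h2 : wCoeff n (C (-ε) * (X none : MvPowerSeries (Option τ) ℂ) ^ ((k : ℕ) - 1)) =
            C (-ε) * if n = (k : ℕ) - 1 then 1 else 0 := by
          simp only [wCoeff, map_mul, optionEquivLeft_C, map_pow, optionEquivLeft_X_none,
            PowerSeries.coeff_C_mul, PowerSeries.coeff_X_pow]
        rw [h2]
        by_cases hij : j = i
        · subst hij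
          rw [hi] at hj
          obtain rfl := Option.some_injective _ hj
          simp
        · have hne : n ≠ (k : ℕ) - 1 := by
            intro h
            apply hij
            apply hκ j i k hj
            rw [hi]
            congr 1
            apply PNat.coe_injective
            have := k.pos
            simp only [Nat.succPNat_coe]
            omega
          rw [if_neg hne, pderiv_X_of_ne hij]
          simp
  simp only [D₁, D₂, AddMonoidHom.mk'_apply] at key
  rw [key, mul_comm]

end WCoeff

/-! ### Translations with two spectral variables -/

section LiftedShift

variable {τ : Type*}

/-- The labelling `κ` of `τ`, with the additional variable unlabelled. -/
def optLabel (κ : τ → Option ℕ+) : Option τ → Option ℕ+ := fun o => o.bind κ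

theorem InjLabel.optLabel {κ : τ → Option ℕ+} (hκ : InjLabel κ) : InjLabel (optLabel κ) := by
  rintro (_ | i) (_ | j) k hi hj
  · rfl
  · simp [TwoDKP.optLabel] at hi
  · simp [TwoDKP.optLabel] at hj
  · exact congrArg some (hκ i j k hi hj)

theorem hasSubst_inc_comp {σ : Type*} {c : σ → MvPowerSeries τ ℂ} (hc : HasSubst c) :
    HasSubst (fun o : Option σ => o.elim (X none) fun i => inc (c i)) := by
  refine hasSubst_option ?_ (by simp)
  have h := hc.comp (hasSubst_inc (τ := τ))
  simp only [coe_substAlgHom] at h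
  exact h

/-- `F(t + ε[x], y)` as a series in `t`, `x` and `y`, for a series `F(t, w)`. -/
def lsh (ε : ℂ) (κ : τ → Option ℕ+) (F : MvPowerSeries (Option τ) ℂ) :
    MvPowerSeries (Option (Option τ)) ℂ :=
  subst (fun o : Option τ => o.elim (X none) fun i => inc (gshift ε κ i)) F

theorem hasSubst_lsh (ε : ℂ) {κ : τ → Option ℕ+} (hκ : InjLabel κ) :
    HasSubst (fun o : Option τ => o.elim (X none) fun i => inc (gshift ε κ i)) :=
  hasSubst_inc_comp (hasSubst_gshift ε hκ)

theorem constantCoeff_lsh_var (ε : ℂ) (κ : τ → Option ℕ+) (o : Option τ) :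
    constantCoeff (o.elim (X none) fun i => inc (gshift ε κ i)) = 0 := by
  rcases o with _ | i
  · simp
  · simp [constantCoeff_inc, constantCoeff_gshift]

theorem constantCoeff_lsh (ε : ℂ) {κ : τ → Option ℕ+} (hκ : InjLabel κ)
    (F : MvPowerSeries (Option τ) ℂ) : constantCoeff (lsh ε κ F) = constantCoeff F :=
  constantCoeff_subst_of_zero (hasSubst_lsh ε hκ) (constantCoeff_lsh_var ε κ) F

theorem lsh_mul (ε : ℂ) {κ : τ → Option ℕ+} (hκ : InjLabel κ)
    (F G : MvPowerSeries (Option τ) ℂ) : lsh ε κ (F * G) = lsh ε κ F * lsh ε κ G :=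
  subst_mul (hasSubst_lsh ε hκ) F G

theorem dlog_none_lsh (ε : ℂ) {κ : τ → Option ℕ+} (hκ : InjLabel κ)
    {F : MvPowerSeries (Option τ) ℂ} (hF : constantCoeff F ≠ 0) :
    dlog none (lsh ε κ F) = lsh ε κ (dlog none F) := by
  classical
  refine dlog_subst (hasSubst_lsh ε hκ) (constantCoeff_lsh_var ε κ) none none ?_ hF
  rintro (_ | i)
  · simp
  · simp [pderiv_none_inc]

/-- Translations of t by multiples of [x] and of [y] commute, because each parameter is untouched by
the other translation. -/
theorem shA_optLabel_lsh (ε δ : ℂ) {κ κ' : τ → Option ℕ+} (hκ : InjLabel κ) (hκ' : InjLabel κ')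
    (F : MvPowerSeries (Option τ) ℂ) :
    shA ε (optLabel κ') (lsh δ κ F) = lsh δ κ (shA ε κ' F) := by
  rw [shA, lsh, subst_comp_subst_apply (hasSubst_lsh δ hκ) (hasSubst_shA ε hκ'.optLabel), lsh,
    shA, subst_comp_subst_apply (hasSubst_shA ε hκ') (hasSubst_lsh δ hκ)]
  congr 1
  funext o
  rcases o with _ | i
  · simp only [Option.elim_none, subst_X (hasSubst_shA ε hκ'.optLabel), subst_X (hasSubst_lsh δ hκ)]
  · have h1 := shA_inc ε hκ'.optLabel (gshift δ κ i)
    rw [shA] at h1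
    have h2 := hasSubst_gshift ε hκ'.optLabel
    have h3 := hasSubst_lsh δ hκ
    have h4 : ∀ k : ℕ+, inc (C (δ / ((k : ℕ) : ℂ)) * X none ^ (k : ℕ) :
        MvPowerSeries (Option τ) ℂ) = C (δ / ((k : ℕ) : ℂ)) * X (some none) ^ (k : ℕ) := by
      intro k
      rw [inc, subst_mul hasSubst_inc, subst_C, subst_pow hasSubst_inc, subst_X hasSubst_inc]
    have h5 : inc (X (some i) : MvPowerSeries (Option τ) ℂ) = X (some (some i)) := by
      rw [inc, subst_X hasSubst_inc]
    have h6 : inc (0 : MvPowerSeries (Option τ) ℂ) = 0 := subst_zero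
    simp only [Option.elim_some]
    have hg : ∀ (η : ℂ) (μ : τ → Option ℕ+), gshift η μ i = X (some i) +
      (μ i).elim 0 fun k => C (η / ((k : ℕ) : ℂ)) * X none ^ (k : ℕ) := fun _ _ => rfl
    have hg' : ∀ o : Option τ, gshift ε (optLabel κ') o = X (some o) +
      (o.bind κ').elim 0 fun k => C (ε / ((k : ℕ) : ℂ)) * X none ^ (k : ℕ) := fun _ => rfl
    rw [h1, sh, hg δ κ, hg ε κ', subst_add h2, subst_X h2, subst_add h3, subst_X h3,
      Option.elim_some, hg δ κ]
    rw [show inc (X (some i) + (κ i).elim 0 fun k => C (δ / ((k : ℕ) : ℂ)) * X none ^ (k : ℕ)) =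
      inc (X (some i)) + inc ((κ i).elim 0 fun k => C (δ / ((k : ℕ) : ℂ)) * X none ^ (k : ℕ)) from
      subst_add hasSubst_inc _ _]
    rcases hk : κ i with _ | k <;> rcases hk' : κ' i with _ | k' <;>
      simp [hg', hk', h4, h5, h6, subst_zero, subst_mul h2, subst_mul h3, subst_pow h2,
        subst_pow h3, subst_X h2, subst_X h3]; ring

theorem wCoeff_subst_inc_comp {σ : Type*} {c : σ → MvPowerSeries τ ℂ} (hc : HasSubst c) (n : ℕ)
    (F : MvPowerSeries (Option σ) ℂ) :
    wCoeff n (subst (fun o : Option σ => o.elim (X none) fun i => inc (c i)) F) =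
      subst c (wCoeff n F) := by
  have h := hasSubst_inc_comp hc
  let ψ₁ : MvPowerSeries (Option σ) ℂ →+* PowerSeries (MvPowerSeries τ ℂ) :=
    (optionEquivLeft τ ℂ).toAlgHom.toRingHom.comp (substAlgHom (R := ℂ) h).toRingHom
  let ψ₂ : MvPowerSeries (Option σ) ℂ →+* PowerSeries (MvPowerSeries τ ℂ) :=
    (PowerSeries.map (substAlgHom (R := ℂ) hc).toRingHom).comp
      (optionEquivLeft σ ℂ).toAlgHom.toRingHom
  have h₁ : ∀ F, ψ₁ F = optionEquivLeft τ ℂ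
      (subst (fun o : Option σ => o.elim (X none) fun i => inc (c i)) F) := fun F => by
    rw [← substAlgHom_apply h]; rfl
  have h₂ : ∀ F n, PowerSeries.coeff n (ψ₂ F) = subst c (wCoeff n F) := fun F n => by
    rw [← substAlgHom_apply hc]; rfl
  have h₂' : ∀ F, ψ₂ F = PowerSeries.map (substAlgHom (R := ℂ) hc).toRingHom
    (optionEquivLeft σ ℂ F) := fun F => rfl
  have hp : ψ₁.comp (MvPolynomial.coeToMvPowerSeries.ringHom (R := ℂ) (σ := Option σ)) =
      ψ₂.comp MvPolynomial.coeToMvPowerSeries.ringHom := by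
    refine MvPolynomial.ringHom_ext (fun r => ?_) (fun i => ?_)
    · simp [h₁, h₂']
    · rcases i with _ | i
      · simp [h₁, h₂', subst_X h]
      · simp [h₁, h₂', subst_X h, subst_X hc, optionEquivLeft_inc]
  rw [← h₂, wCoeff, ← h₁]
  ext e
  refine FinDet.eq_of_polynomial
    (ℓ₁ := (coeff e).toAddMonoidHom.comp ((PowerSeries.coeff n).toAddMonoidHom.comp
      ψ₁.toAddMonoidHom))
    (ℓ₂ := (coeff e).toAddMonoidHom.comp ((PowerSeries.coeff n).toAddMonoidHom.comp
      ψ₂.toAddMonoidHom)) ?_ ?_ ?_ F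
  · exact (((coeffFin_wCoeff n).comp (coeffFin_subst (R := ℂ) h)) e).congr
      fun F => congrArg (fun q => coeff e (PowerSeries.coeff n q)) (h₁ F)
  · exact (((coeffFin_subst (R := ℂ) hc).comp (coeffFin_wCoeff n)) e).congr
      fun F => congrArg (coeff e) (h₂ F n)
  · intro p
    exact congrArg (fun q => coeff e (PowerSeries.coeff n q)) (DFunLike.congr_fun hp p)

theorem wCoeff_lsh (ε : ℂ) {κ : τ → Option ℕ+} (hκ : InjLabel κ) (n : ℕ)
    (F : MvPowerSeries (Option τ) ℂ) : wCoeff n (lsh ε κ F) = sh ε κ (wCoeff n F) :=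
  wCoeff_subst_inc_comp (hasSubst_gshift ε hκ) n F

end LiftedShift

/-! ### The formal Poincaré lemma -/

section Integration

variable {σ : Type*}

/-- The formal Poincaré lemma. -/
theorem exists_pderiv_eq (ω : σ → MvPowerSeries σ ℂ)
    (h : ∀ i j, pderiv ℂ i (ω j) = pderiv ℂ j (ω i)) :
    ∃ f : MvPowerSeries σ ℂ, constantCoeff f = 0 ∧ ∀ i, pderiv ℂ i f = ω i := by
  classical
  have key : ∀ (d : σ →₀ ℕ) (i j : σ), d i ≠ 0 → d j ≠ 0 →
      coeff (d - Finsupp.single i 1) (ω i) / (d i : ℂ) =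
        coeff (d - Finsupp.single j 1) (ω j) / (d j : ℂ) := by
    intro d i j hi hj
    by_cases hij : i = j
    · rw [hij]
    obtain ⟨e, rfl⟩ : ∃ e, d = e + Finsupp.single i 1 + Finsupp.single j 1 := by
      refine ⟨d - Finsupp.single i 1 - Finsupp.single j 1, ?_⟩
      ext k
      simp only [Finsupp.add_apply, Finsupp.tsub_apply, Finsupp.single_apply]
      split_ifs with h1 h2 h2
      · exact absurd (h1.trans h2.symm) hij
      · subst h1; omega
      · subst h2; omega
      · omega
    have e1 : e + Finsupp.single i 1 + Finsupp.single j 1 - Finsupp.single j 1 =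
      e + Finsupp.single i 1 := add_tsub_cancel_right _ _
    have e2 : e + Finsupp.single i 1 + Finsupp.single j 1 - Finsupp.single i 1 =
      e + Finsupp.single j 1 := by rw [add_right_comm]; exact add_tsub_cancel_right _ _
    have h3 := congrArg (coeff e) (h i j)
    rw [coeff_pderiv, coeff_pderiv] at h3
    rw [e1, e2]
    have n1 : ((e i : ℂ) + 1) ≠ 0 := by exact_mod_cast Nat.succ_ne_zero (e i)
    have n2 : ((e j : ℂ) + 1) ≠ 0 := by exact_mod_cast Nat.succ_ne_zero (e j)
    simp only [Finsupp.add_apply, Finsupp.single_eq_same, Finsupp.single_eq_of_ne hij,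
      Finsupp.single_eq_of_ne (Ne.symm hij), add_zero, Nat.cast_add, Nat.cast_one]
    rw [div_eq_div_iff n1 n2, h3]
  -- Any variable occurring in `d` can be used to integrate the coefficient at `d`; closedness, in
  -- the form of `key`, makes the choice irrelevant.
  let f : MvPowerSeries σ ℂ := fun d =>
    if hd : ∃ i, d i ≠ 0 then coeff (d - Finsupp.single hd.choose 1) (ω hd.choose) /
      (d hd.choose : ℂ) else 0
  have hf : ∀ d i, d i ≠ 0 → coeff d f = coeff (d - Finsupp.single i 1) (ω i) / (d i : ℂ) := by
    intro d i hi
    have hd : ∃ i, d i ≠ 0 := ⟨i, hi⟩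
    have : coeff d f = coeff (d - Finsupp.single hd.choose 1) (ω hd.choose) /
      (d hd.choose : ℂ) := dif_pos hd
    rw [this]
    exact key d _ _ hd.choose_spec hi
  refine ⟨f, ?_, fun i => ?_⟩
  · rw [← coeff_zero_eq_constantCoeff_apply]
    exact dif_neg (by simp)
  · ext d
    rw [coeff_pderiv, hf _ i (by simp), add_tsub_cancel_right]
    have : ((d i : ℂ) + 1) ≠ 0 := by exact_mod_cast Nat.succ_ne_zero (d i)
    simp only [Finsupp.add_apply, Finsupp.single_eq_same, Nat.cast_add, Nat.cast_one]
    field_simp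

theorem pderiv_exp_subst {f : MvPowerSeries σ ℂ} (hf : constantCoeff f = 0) (i : σ) :
    pderiv ℂ i ((PowerSeries.exp ℂ).subst f) = (PowerSeries.exp ℂ).subst f * pderiv ℂ i f := by
  classical
  have h := PowerSeries.HasSubst.of_constantCoeff_zero hf
  rw [PowerSeries.subst, pderiv_subst h.const () i (pderiv ℂ i f) (by simp)]
  congr 2
  exact PowerSeries.derivative_exp ℂ

/-- A series with prescribed logarithmic derivatives. -/
theorem exists_dlog_eq (ω : σ → MvPowerSeries σ ℂ)
    (h : ∀ i j, pderiv ℂ i (ω j) = pderiv ℂ j (ω i)) :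
    ∃ f : MvPowerSeries σ ℂ, constantCoeff f = 1 ∧ ∀ i, dlog i f = ω i := by
  obtain ⟨f, hf0, hf⟩ := exists_pderiv_eq ω h
  have hc : constantCoeff ((PowerSeries.exp ℂ).subst f) = 1 := by
    have h1 := PowerSeries.constantCoeff_subst_eq_zero hf0 (PowerSeries.exp ℂ - 1) (by simp)
    have hs := PowerSeries.HasSubst.of_constantCoeff_zero hf0
    have h2 : (1 : PowerSeries ℂ).subst f = 1 := by
      rw [← PowerSeries.coe_substAlgHom hs, map_one]
    rw [PowerSeries.subst_sub hs, h2, map_sub, sub_eq_zero] at h1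
    rw [h1, map_one]
  refine ⟨(PowerSeries.exp ℂ).subst f, hc, fun i => ?_⟩
  rw [dlog, pderiv_exp_subst hf0, hf, mul_right_comm, MvPowerSeries.mul_inv_cancel _ (by simp [hc]),
    one_mul]

end Integration

/-- The variable `t^{(a)}_k` is labelled by `k`, those of the other component are unlabelled. -/
def label (a : Fin 2) : Time → Option ℕ+ := fun i => if i.1 = a then some i.2 else none

theorem label_eq_some {a : Fin 2} {i : Time} {k : ℕ+} (h : label a i = some k) : i = (a, k) := by
  unfold label at h
  split_ifs at h with h1
  exact Prod.ext h1 (Option.some_injective _ h)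

theorem injLabel_label (a : Fin 2) : InjLabel (label a) := fun _ _ _ hi hj =>
  (label_eq_some hi).trans (label_eq_some hj).symm

/-! ### Cocycles are coboundaries up to constants -/

section Cocycle

variable {I : Type*} [AddCommGroup I] (s : Fin 2 → I)

/-- The compatibility condition
`P_a(m,t,x) P_b(m+s_a,t-[x]_a,y) = P_b(m,t,y) P_a(m+s_b,t-[y]_b,x)`. -/
def IsCocycle (P : Fin 2 → I → MvPowerSeries (Option Time) ℂ) : Prop :=
  ∀ a b m, inc (P a m) * lsh (-1) (label a) (P b (m + s a)) =
    lsh 0 (label a) (P b m) * sh (-1) (optLabel (label b)) (P a (m + s b))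

variable (P : Fin 2 → I → MvPowerSeries (Option Time) ℂ)

/-- The logarithmic derivative of `P_b(m)` with respect to `w`, at `t + [w]_b`. -/
def shiftedDlog (b : Fin 2) (m : I) : MvPowerSeries (Option Time) ℂ :=
  shA 1 (label b) (dlog none (P b m))

/-- The logarithmic derivatives of the tau function. -/
def tauDlog (i : Time) (m : I) : Fun :=
  -wCoeff i.2.natPred (shiftedDlog P i.1 (m - s i.1))

variable {s P}

/-- Logarithmic y-derivative of the cocycle identity: the factor P_a(m,t,x) does not contain y and
drops out. After the translation by [y]_b, Taylor's formula turns the factor P_a(m+s_b,t-[y]_b,x)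
into a derivative in t^{(b)}_{n+1}. -/
theorem sh_wCoeff_shiftedDlog (hP : ∀ a m, constantCoeff (P a m) ≠ 0) (h : IsCocycle s P)
    (a b : Fin 2) (n : ℕ) (m : I) :
    sh (-1) (label a) (wCoeff n (shiftedDlog P b (m + s a))) =
      inc (wCoeff n (shiftedDlog P b m)) - dlog (some (b, n.succPNat)) (P a (m + s b)) := by
  have ha := injLabel_label a
  have hb := injLabel_label b
  have h1 := congrArg (dlog none) (h a b m)
  have hn : dlog none (inc (P a m)) = 0 := by rw [dlog, pderiv_none_inc, zero_mul]
  rw [dlog_mul _ (by rw [constantCoeff_inc]; exact hP _ _)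
      (by rw [constantCoeff_lsh _ ha]; exact hP _ _),
    dlog_mul _ (by rw [constantCoeff_lsh _ ha]; exact hP _ _)
      (by rw [constantCoeff_sh _ hb.optLabel]; exact hP _ _), hn, zero_add,
    dlog_none_lsh _ ha (hP _ _), dlog_none_lsh _ ha (hP _ _)] at h1
  have h2 := congrArg (shA 1 (optLabel (label b))) h1
  have hadd : ∀ F G, shA 1 (optLabel (label b)) (F + G) =
      shA 1 (optLabel (label b)) F + shA 1 (optLabel (label b)) G := fun F G =>
    subst_add (hasSubst_shA 1 hb.optLabel) F G
  rw [hadd, shA_optLabel_lsh _ _ ha hb, shA_optLabel_lsh _ _ ha hb, dlog, dlog, dlog,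
    shA_mul _ hb.optLabel, shA_inv _ hb.optLabel
      (by rw [constantCoeff_sh _ hb.optLabel]; exact hP _ _), shA_sh _ _ hb.optLabel,
    add_neg_cancel, sh_zero, ← inc_inv (hP _ _)] at h2
  have h3 := congrArg (wCoeff n) h2
  rw [wCoeff_add, wCoeff_lsh _ ha, wCoeff_lsh _ ha, mul_comm _ (inc _), wCoeff_inc_mul,
    wCoeff_shA_pderiv_sh 1 hb.optLabel n (some (b, n.succPNat)) (by simp [optLabel, label]),
    sh_zero] at h3
  simp only [shiftedDlog, dlog]
  rw [h3, map_one]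
  ring

/-- The infinitesimal coboundary equation: it is what P_a(m) = τ_{m+s_a}(t-[w]_a)/τ_m(t) would give.
The shift by `s i.1` in `tauDlog` compensates for the `m + s b` in `sh_wCoeff_shiftedDlog`. -/
theorem dlog_eq_sub (hP : ∀ a m, constantCoeff (P a m) ≠ 0) (h : IsCocycle s P)
    (a : Fin 2) (i : Time) (m : I) :
    dlog (some i) (P a m) =
      sh (-1) (label a) (tauDlog s P i (m + s a)) - inc (tauDlog s P i m) := by
  obtain ⟨b, k⟩ := i
  have h1 := sh_wCoeff_shiftedDlog hP h a b k.natPred (m - s b)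
  rw [PNat.succPNat_natPred, sub_add_cancel, sub_add_eq_add_sub] at h1
  have e1 : ∀ F, sh (-1) (label a) (-F) = -sh (-1) (label a) F := fun F => by
    simp only [sh, ← substAlgHom_apply (hasSubst_gshift (-1) (injLabel_label a)), map_neg]
  have e2 : ∀ F : Fun, inc (-F) = -inc F := fun F => by
    simp only [inc, ← substAlgHom_apply hasSubst_inc, map_neg]
  simp only [tauDlog]
  rw [e1, e2, h1]
  ring

theorem wCoeff_shA_pderiv_sh_label (a : Fin 2) (k : ℕ+) (F : Fun) :
    wCoeff k.natPred (shA 1 (label a) (pderiv ℂ none (sh (-1) (label a) F))) =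
      -pderiv ℂ (a, k) F := by
  rw [wCoeff_shA_pderiv_sh 1 (injLabel_label a) k.natPred (a, k) (by simp [label])]
  simp

/-- Applying ∂_w to `dlog_eq_sub` removes the term without w. Interchanging the derivatives of log
P_a and taking the coefficient of w^{k-1} at t + [w]_a gives the two mixed derivatives, both with a
minus sign. -/
theorem tauDlog_closed (hP : ∀ a m, constantCoeff (P a m) ≠ 0) (h : IsCocycle s P)
    (i j : Time) (m : I) :
    pderiv ℂ i (tauDlog s P j m) = pderiv ℂ j (tauDlog s P i m) := by
  obtain ⟨a, k⟩ := j
  have ha := injLabel_label a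
  have h1 := congrArg (pderiv ℂ none) (dlog_eq_sub hP h a i (m - s a))
  rw [map_sub, pderiv_none_inc, sub_zero, pderiv_dlog_comm, sub_add_cancel] at h1
  have h2 := congrArg (fun F => wCoeff k.natPred (shA 1 (label a) F)) h1
  rw [wCoeff_shA_pderiv_sh_label, ← pderiv_some_shA _ ha, wCoeff_pderiv_some] at h2
  simp only [tauDlog, map_neg, shiftedDlog] at h2 ⊢
  rw [h2, neg_neg]

theorem eq_C_of_dlog_eq_zero {σ : Type*} {U : MvPowerSeries σ ℂ} (hU : constantCoeff U ≠ 0)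
    (h : ∀ i, dlog i U = 0) : U = C (constantCoeff U) := by
  refine pderiv.ext (fun i => ?_) (by simp)
  have h1 := congrArg (· * U) (h i)
  simp only [dlog, mul_assoc, MvPowerSeries.inv_mul_cancel U hU, mul_one, zero_mul] at h1
  rw [h1, pderiv_C]

/-- This treats the remaining variable w. At t + [w]_a Taylor's formula expands the left side, and
`tauDlog` was defined from exactly the corresponding coefficients of the right side; translating
back is injective. -/
theorem dlog_none_sh_of_dlog_eq (hτ : Fun) (hτ0 : constantCoeff hτ ≠ 0) (a : Fin 2) (m : I)
    (hd : ∀ i, dlog i hτ = tauDlog s P i (m + s a)) :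
    dlog none (sh (-1) (label a) hτ) = dlog none (P a m) := by
  have ha := injLabel_label a
  have key : shA 1 (label a) (dlog none (sh (-1) (label a) hτ)) =
      shA 1 (label a) (dlog none (P a m)) := by
    refine wCoeff_ext fun n => ?_
    have h1 : n = n.succPNat.natPred := (Nat.natPred_succPNat n).symm
    rw [dlog, shA_mul _ ha, shA_inv _ ha (by rwa [constantCoeff_sh _ ha]), shA_sh _ _ ha,
      add_neg_cancel, sh_zero, ← inc_inv hτ0, mul_comm, wCoeff_inc_mul, h1,
      wCoeff_shA_pderiv_sh_label, mul_neg, mul_comm]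
    have h2 := hd (a, n.succPNat)
    rw [dlog] at h2
    rw [h2, tauDlog, neg_neg, add_sub_cancel_right, shiftedDlog]
  have h2 := congrArg (shA (-1) (label a)) key
  rwa [shA_shA _ _ ha, shA_shA _ _ ha, neg_add_cancel, shA_zero, shA_zero] at h2

/-- A cocycle is a coboundary, up to constants. -/
theorem IsCocycle.exists_tau (hP : ∀ a m, constantCoeff (P a m) ≠ 0) (h : IsCocycle s P) :
    ∃ τ : I → Fun, (∀ m, constantCoeff (τ m) = 1) ∧ ∀ a m,
      P a m * inc (τ m) =
        C (constantCoeff (P a m)) * sh (-1) (label a) (τ (m + s a)) := by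
  choose τ hτ1 hτ using fun m => exists_dlog_eq (fun i => tauDlog s P i m)
    fun i j => tauDlog_closed hP h i j m
  have hτ0 : ∀ m, constantCoeff (τ m) ≠ 0 := fun m => by simp [hτ1]
  refine ⟨τ, hτ1, fun a m => ?_⟩
  have ha := injLabel_label a
  have c1 : constantCoeff (inc (τ m)) = 1 := by rw [constantCoeff_inc, hτ1]
  have c2 : constantCoeff (sh (-1) (label a) (τ (m + s a))) = 1 := by
    rw [constantCoeff_sh _ ha, hτ1]
  have hc : constantCoeff (P a m * inc (τ m) * (sh (-1) (label a) (τ (m + s a)))⁻¹) =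
      constantCoeff (P a m) := by simp [c1, c2]
  -- The quotient of the two sides has zero logarithmic derivative in w and in every time, so it
  -- equals its constant term.
  have key := eq_C_of_dlog_eq_zero (U := P a m * inc (τ m) *
    (sh (-1) (label a) (τ (m + s a)))⁻¹) (by rw [hc]; exact hP a m) fun o => by
      rw [dlog_mul _ (by simpa [c1] using hP a m) (by simp [c2]),
        dlog_mul _ (hP a m) (by simp [c1]), dlog_inv _ (by simp [c2])]
      rcases o with _ | i
      · rw [dlog_none_sh_of_dlog_eq _ (hτ0 _) a m (hτ (m + s a)), dlog, dlog, pderiv_none_inc]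
        ring
      · rw [dlog_eq_sub hP h]
        have e1 : dlog (some i) (inc (τ m)) = inc (tauDlog s P i m) := by
          have := dlog_some_sh 0 ha i (hτ0 m)
          rw [sh_zero, sh_zero, hτ] at this
          exact this
        rw [e1, dlog_some_sh _ ha i (hτ0 _), hτ]
        ring
  rw [hc] at key
  rw [← key, mul_assoc, MvPowerSeries.inv_mul_cancel _ (by simp [c2]), mul_one]

end Cocycle

/-! ### Coefficients over Laurent series in w -/

section LaurentCoefficients

variable {σ τ : Type*}

/-- The coefficient of `w ^ n` of a power series over `ℂ((w))`. -/
def hCoeff (n : ℤ) : MvPowerSeries τ K →+ MvPowerSeries τ ℂ where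
  toFun F := fun d => (coeff d F).coeff n
  map_zero' := by ext d; change (coeff d (0 : MvPowerSeries τ K)).coeff n = 0; simp
  map_add' F G := by
    ext d
    change (coeff d (F + G)).coeff n = (coeff d F).coeff n + (coeff d G).coeff n
    simp

theorem coeff_hCoeff (n : ℤ) (F : MvPowerSeries τ K) (d : τ →₀ ℕ) :
    coeff d (hCoeff n F) = (coeff d F).coeff n := rfl

theorem hCoeff_ext {F G : MvPowerSeries τ K} (h : ∀ n, hCoeff n F = hCoeff n G) : F = G := by
  ext d n
  exact congrArg (coeff d) (h n)

/-- Power series over `ℂ` as power series over `ℂ((w))` not depending on `w`. -/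
def mapC : MvPowerSeries τ ℂ →+* MvPowerSeries τ K := MvPowerSeries.map (HahnSeries.C : ℂ →+* K)

theorem coeff_mapC (F : MvPowerSeries τ ℂ) (d : τ →₀ ℕ) :
    coeff d (mapC F) = HahnSeries.C (coeff d F) := rfl

theorem mapC_X (i : τ) : mapC (X i : MvPowerSeries τ ℂ) = X i := by simp [mapC]

theorem hCoeff_mapC_mul (n : ℤ) (F : MvPowerSeries τ ℂ) (G : MvPowerSeries τ K) :
    hCoeff n (mapC F * G) = F * hCoeff n G := by
  classical
  ext d
  rw [coeff_hCoeff, coeff_mul, coeff_mul]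
  rw [HahnSeries.coeff_sum]
  refine Finset.sum_congr rfl fun p _ => ?_
  rw [coeff_mapC, HahnSeries.C_mul_eq_smul, HahnSeries.coeff_smul, coeff_hCoeff, smul_eq_mul]

theorem hCoeff_C_single_mul (n k : ℤ) (F : MvPowerSeries τ K) :
    hCoeff n (C (HahnSeries.single k (1 : ℂ)) * F) = hCoeff (n - k) F := by
  ext d
  rw [coeff_hCoeff, coeff_C_mul, coeff_hCoeff]
  have := HahnSeries.coeff_single_mul_add (r := (1 : ℂ)) (x := coeff d F) (a := n - k) (b := k)
  rwa [sub_add_cancel, one_mul] at this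

/-- Coefficients commute with substitutions that do not involve `w`. -/
theorem hCoeff_subst_mapC {c : σ → MvPowerSeries τ ℂ} (hc : HasSubst c) (n : ℤ)
    (F : MvPowerSeries σ K) :
    hCoeff n (subst (fun i => mapC (c i)) F) = subst c (hCoeff n F) := by
  have hcK : HasSubst (fun i => mapC (c i)) := hc.map (S := K) (HahnSeries.C : ℂ →+* K)
  ext e
  rw [coeff_hCoeff, coeff_subst hcK, coeff_subst hc]
  have h1 := AddMonoidHom.map_finsum (HahnSeries.coeff.addMonoidHom (R := ℂ) n)
    (coeff_subst_finite hcK F e)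
  refine h1.trans (finsum_congr fun d => ?_)
  have h2 : (d.prod fun s k => mapC (c s) ^ k) = mapC (d.prod fun s k => c s ^ k) := by
    simp [Finsupp.prod, map_prod, map_pow]
  rw [h2, coeff_mapC]
  change (coeff d F * HahnSeries.C _).coeff n = _
  rw [mul_comm, HahnSeries.C_mul_eq_smul, HahnSeries.coeff_smul, smul_eq_mul, mul_comm]
  rfl

/-- A power series in `t` and `w` as a power series in `t` over `ℂ((w))`. -/
def col : MvPowerSeries (Option τ) ℂ →+* MvPowerSeries τ K where
  toFun G := fun d => HahnSeries.ofPowerSeries ℤ ℂ (PowerSeries.mk fun n => coeff d (wCoeff n G))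
  map_one' := by
    classical
    ext1 d
    have : (PowerSeries.mk fun n => coeff d (wCoeff n (1 : MvPowerSeries (Option τ) ℂ))) =
        if d = 0 then 1 else 0 := by
      ext n
      rw [PowerSeries.coeff_mk, wCoeff, map_one, PowerSeries.coeff_one]
      split_ifs with h1 h2 h2 <;> simp [coeff_one, h1, h2]
    change HahnSeries.ofPowerSeries ℤ ℂ _ = coeff d (1 : MvPowerSeries τ K)
    rw [this, coeff_one]
    split_ifs <;> simp
  map_zero' := by
    ext1 d
    have : (PowerSeries.mk fun n => coeff d (wCoeff n (0 : MvPowerSeries (Option τ) ℂ))) = 0 := by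
      ext n
      simp [wCoeff]
    change HahnSeries.ofPowerSeries ℤ ℂ _ = coeff d (0 : MvPowerSeries τ K)
    rw [this, map_zero, map_zero]
  map_add' F G := by
    ext1 d
    have : (PowerSeries.mk fun n => coeff d (wCoeff n (F + G))) =
        (PowerSeries.mk fun n => coeff d (wCoeff n F)) +
          PowerSeries.mk fun n => coeff d (wCoeff n G) := by
      ext n
      simp [wCoeff]
    change HahnSeries.ofPowerSeries ℤ ℂ _ = _
    rw [this, map_add]
    rfl
  map_mul' F G := by
    classical
    ext1 d
    have : (PowerSeries.mk fun n => coeff d (wCoeff n (F * G))) =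
        ∑ p ∈ Finset.HasAntidiagonal.antidiagonal d,
          (PowerSeries.mk fun n => coeff p.1 (wCoeff n F)) *
          PowerSeries.mk fun n => coeff p.2 (wCoeff n G) := by
      ext n
      simp only [PowerSeries.coeff_mk, map_sum, PowerSeries.coeff_mul, wCoeff, map_mul,
        MvPowerSeries.coeff_mul]
      exact Finset.sum_comm
    change HahnSeries.ofPowerSeries ℤ ℂ _ = _
    rw [this, map_sum]
    refine Eq.trans ?_ (coeff_mul (R := K) d _ _).symm
    exact Finset.sum_congr rfl fun p _ => map_mul _ _ _

theorem coeff_col (G : MvPowerSeries (Option τ) ℂ) (d : τ →₀ ℕ) : coeff d (col G) =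
    HahnSeries.ofPowerSeries ℤ ℂ (PowerSeries.mk fun n => coeff d (wCoeff n G)) := rfl

theorem hCoeff_natCast_col (n : ℕ) (G : MvPowerSeries (Option τ) ℂ) :
    hCoeff n (col G) = wCoeff n G := by
  ext d
  rw [coeff_hCoeff, coeff_col, HahnSeries.ofPowerSeries_apply_coeff, PowerSeries.coeff_mk]

theorem hCoeff_neg_col {n : ℤ} (hn : n < 0) (G : MvPowerSeries (Option τ) ℂ) :
    hCoeff n (col G) = 0 := by
  ext d
  rw [coeff_hCoeff, coeff_col, HahnSeries.ofPowerSeries_apply, HahnSeries.embDomain_of_notMem_range]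
  · simp
  · rintro ⟨k, hk⟩
    have : (k : ℤ) = n := hk
    omega

theorem collect_eq_col (G : MvPowerSeries (Option Time) ℂ) : collect G = col G := by
  ext1 d
  change HahnSeries.ofPowerSeries ℤ ℂ _ = HahnSeries.ofPowerSeries ℤ ℂ _
  congr 2
  funext n
  rw [coeff_wCoeff]
  congr 2
  ext (_ | i) <;> simp

theorem subst_mapC_col {c : σ → MvPowerSeries τ ℂ} (hc : HasSubst c)
    (G : MvPowerSeries (Option σ) ℂ) :
    subst (fun i => mapC (c i)) (col G) =
      col (subst (fun o : Option σ => o.elim (X none) fun i => inc (c i)) G) := by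
  refine hCoeff_ext fun n => ?_
  rw [hCoeff_subst_mapC hc]
  rcases lt_or_ge n 0 with hn | hn
  · rw [hCoeff_neg_col hn, hCoeff_neg_col hn, subst_zero]
  · lift n to ℕ using hn
    rw [hCoeff_natCast_col, hCoeff_natCast_col, wCoeff_subst_inc_comp hc]

theorem col_inc (F : MvPowerSeries τ ℂ) : col (inc F) = mapC F := by
  refine hCoeff_ext fun n => ?_
  ext d
  rw [coeff_hCoeff, coeff_hCoeff, coeff_mapC, coeff_col]
  have : (PowerSeries.mk fun n => coeff d (wCoeff n (inc F))) = PowerSeries.C (coeff d F) := by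
    ext n
    rw [PowerSeries.coeff_mk, wCoeff, optionEquivLeft_inc, PowerSeries.coeff_C,
      PowerSeries.coeff_C]
    split_ifs <;> simp
  rw [this, HahnSeries.ofPowerSeries_C]

theorem col_X_some (i : τ) : col (X (some i)) = X i := by
  have h : (X (some i) : MvPowerSeries (Option τ) ℂ) = inc (X i) := by
    rw [inc, subst_X hasSubst_inc]
  rw [h, col_inc, mapC_X]

theorem col_C (r : ℂ) : col (C r : MvPowerSeries (Option τ) ℂ) = mapC (C r) := by
  have h : (C r : MvPowerSeries (Option τ) ℂ) = inc (C r) := by rw [inc, subst_C]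
  rw [h, col_inc]

theorem col_X_none : col (X none : MvPowerSeries (Option τ) ℂ) =
    C (HahnSeries.single (1 : ℤ) (1 : ℂ)) := by
  classical
  ext1 d
  rw [coeff_col, coeff_C]
  have : (PowerSeries.mk fun n => coeff d (wCoeff n (X none : MvPowerSeries (Option τ) ℂ))) =
      if d = 0 then PowerSeries.X else 0 := by
    ext n
    rw [PowerSeries.coeff_mk, wCoeff, optionEquivLeft_X_none, PowerSeries.coeff_X]
    split_ifs with h1 h2 h2 <;> simp [coeff_one, h1, h2, PowerSeries.coeff_X]
  rw [this]
  split_ifs <;> simp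

end LaurentCoefficients

/-! ### Geometric series and evaluation at w = x -/

section Geometric

variable {τ : Type*}

/-- The geometric series `∑ (X i / w) ^ k`. -/
def geo (i : τ) : MvPowerSeries τ K := by
  classical
  exact fun d => if d = Finsupp.single i (d i) then HahnSeries.single (-(d i : ℤ)) 1 else 0

open Classical in
theorem coeff_geo (i : τ) (d : τ →₀ ℕ) : coeff d (geo i) =
    if d = Finsupp.single i (d i) then HahnSeries.single (-(d i : ℤ)) (1 : ℂ) else 0 := by
  change (if _ then _ else _) = _
  congr

theorem geo_mul (i : τ) :
    geo i * (1 - C (HahnSeries.single (-1 : ℤ) (1 : ℂ)) * X i) = 1 := by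
  classical
  have h : (C (HahnSeries.single (-1 : ℤ) (1 : ℂ)) * X i : MvPowerSeries τ K) =
      monomial (Finsupp.single i 1) (HahnSeries.single (-1 : ℤ) (1 : ℂ)) := by
    rw [X, ← monomial_zero_eq_C_apply, monomial_mul_monomial, zero_add, mul_one]
  rw [h, mul_sub, mul_one]
  ext1 d
  rw [map_sub, coeff_mul_monomial, coeff_geo, coeff_one]
  by_cases hle : Finsupp.single i 1 ≤ d
  · obtain ⟨e, rfl⟩ := exists_add_of_le hle
    have h0 : Finsupp.single i 1 + e ≠ 0 := fun h => by
      have := DFunLike.congr_fun h i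
      simp at this
    have hiff : (Finsupp.single i 1 + e = Finsupp.single i ((Finsupp.single i 1 + e : τ →₀ ℕ) i)) ↔
        e = Finsupp.single i (e i) := by
      rw [Finsupp.add_apply, Finsupp.single_eq_same, Finsupp.single_add, add_right_inj]
    rw [if_neg h0, if_pos hle, add_tsub_cancel_left, coeff_geo]
    by_cases he : e = Finsupp.single i (e i)
    · rw [if_pos (hiff.2 he), if_pos he, HahnSeries.single_mul_single, mul_one, sub_eq_zero]
      congr 2
      simp
    · rw [if_neg (fun h => he (hiff.1 h)), if_neg he, zero_mul, sub_zero]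
  · have hi : d i = 0 := by
      by_contra hne
      apply hle
      intro j
      rw [Finsupp.single_apply]
      split_ifs with hj
      · subst hj; omega
      · exact Nat.zero_le _
    rw [if_neg hle, sub_zero, hi, Finsupp.single_zero]
    split_ifs <;> rfl

theorem hCoeff_zero_geo (i : τ) : hCoeff 0 (geo i) = 1 := by
  classical
  ext d
  rw [coeff_hCoeff, coeff_geo, coeff_one]
  by_cases hd : d = 0
  · subst hd
    simp
  · rw [if_neg hd]
    split_ifs with h
    · rw [HahnSeries.coeff_single_of_ne]
      intro h0
      apply hd
      rw [h, show d i = 0 by omega, Finsupp.single_zero]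
    · rfl

/-- Evaluation at `w = X i`. -/
def evw (i : τ) (G : MvPowerSeries (Option τ) ℂ) : MvPowerSeries τ ℂ :=
  subst (fun o : Option τ => o.elim (X i) X) G

theorem hasSubst_evw (i : τ) :
    HasSubst (fun o : Option τ => o.elim (X i) (X : τ → MvPowerSeries τ ℂ)) :=
  hasSubst_option HasSubst.X (by simp)

/-- A residue at w = x: in degree zero of w, the product of ∑ x^k w^{-k} and ∑ G_n w^n leaves ∑ G_n
x^n. -/
theorem hCoeff_zero_geo_mul_col (i : τ) (G : MvPowerSeries (Option τ) ℂ) :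
    hCoeff 0 (geo i * col G) = evw i G := by
  classical
  let Φ₁ : MvPowerSeries (Option τ) ℂ →+ MvPowerSeries τ ℂ :=
    (hCoeff 0).comp ((AddMonoidHom.mulLeft (geo i)).comp col.toAddMonoidHom)
  let Φ₂ : MvPowerSeries (Option τ) ℂ →+ MvPowerSeries τ ℂ :=
    (substAlgHom (R := ℂ) (hasSubst_evw i)).toRingHom.toAddMonoidHom
  have e₁ : ∀ F, Φ₁ F = hCoeff 0 (geo i * col F) := fun _ => rfl
  have e₂ : ∀ F, Φ₂ F = evw i F := fun F => substAlgHom_apply (hasSubst_evw i) F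
  rw [← e₁, ← e₂]
  refine CoeffFin.eq_of_polynomial ?_ ?_ (fun p => ?_) G
  · intro d
    -- The factor `geo i` contributes x^k w^{-k}, so it meets only the coefficient of w^k of `F`,
    -- with k the exponent taken from `d`.
    refine ⟨(Finset.HasAntidiagonal.antidiagonal d).image fun p => p.2.optionElim (p.1 i),
      fun F hF => ?_⟩
    simp only [e₁]
    rw [coeff_hCoeff, coeff_mul, HahnSeries.coeff_sum]
    refine Finset.sum_eq_zero fun p hp => ?_
    rw [coeff_geo]
    split_ifs with h
    · have h1 := HahnSeries.coeff_single_mul_add (r := (1 : ℂ)) (x := coeff p.2 (col F))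
        (a := ((p.1 i : ℕ) : ℤ)) (b := -((p.1 i : ℕ) : ℤ))
      rw [add_neg_cancel, one_mul] at h1
      rw [h1, ← coeff_hCoeff, hCoeff_natCast_col, coeff_wCoeff]
      exact hF _ (Finset.mem_image_of_mem (fun p : (τ →₀ ℕ) × (τ →₀ ℕ) =>
        p.2.optionElim (p.1 i)) hp)
    · simp
  · exact fun e => ((coeffFin_subst (R := ℂ) (hasSubst_evw i)) e).congr
      fun F => congrArg (coeff e) (e₂ F)
  · induction p using MvPolynomial.induction_on with
    | C r =>
      rw [MvPolynomial.coe_C, e₁, e₂, col_C, mul_comm, hCoeff_mapC_mul, hCoeff_zero_geo, evw,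
        subst_C, mul_one]
    | add p q hp hq => rw [MvPolynomial.coe_add, map_add, map_add, hp, hq]
    | mul_X p o hp =>
      rw [e₁, e₂] at hp ⊢
      rw [MvPolynomial.coe_mul, MvPolynomial.coe_X, evw, subst_mul (hasSubst_evw i),
        subst_X (hasSubst_evw i), map_mul col, ← mul_assoc]
      rw [evw] at hp
      rcases o with _ | j
      -- Here w/(1 - x/w) = w + x/(1 - x/w), and w times a power series in w has no term of degree
      -- zero.
      · have h1 : geo i * col (p : MvPowerSeries (Option τ) ℂ) * col (X none) =
            C (HahnSeries.single (1 : ℤ) (1 : ℂ)) * col (p : MvPowerSeries (Option τ) ℂ) +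
              mapC (X i) * (geo i * col (p : MvPowerSeries (Option τ) ℂ)) := by
          have h2 := geo_mul i
          have h3 : (C (HahnSeries.single (-1 : ℤ) (1 : ℂ)) : MvPowerSeries τ K) *
              C (HahnSeries.single (1 : ℤ) (1 : ℂ)) = 1 := by
            rw [← map_mul, HahnSeries.single_mul_single]
            simp
          rw [col_X_none, mapC_X]
          linear_combination (C (HahnSeries.single (1 : ℤ) (1 : ℂ)) *
            col (p : MvPowerSeries (Option τ) ℂ)) * h2 +
            X i * geo i * col (p : MvPowerSeries (Option τ) ℂ) * h3
        rw [h1, map_add, hCoeff_C_single_mul, hCoeff_neg_col (by norm_num), hCoeff_mapC_mul, hp,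
          zero_add, mul_comm]
        rfl
      · rw [col_X_some, ← mapC_X, mul_comm, hCoeff_mapC_mul, hp, mul_comm]
        rfl

/-- Partial fractions: (x - y) w⁻¹ / ((1 - x/w)(1 - y/w)) = 1/(1 - x/w) - 1/(1 - y/w), and each term
on the right evaluates `G`. -/
theorem hCoeff_geo_mul_geo_mul_col {i j : τ} (G : MvPowerSeries (Option τ) ℂ)
    (h : hCoeff 0 (C (HahnSeries.single (-1 : ℤ) (1 : ℂ)) * (geo i * geo j) * col G) = 0) :
    evw i G = evw j G := by
  have h1 : mapC (X i - X j) *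
      (C (HahnSeries.single (-1 : ℤ) (1 : ℂ)) * (geo i * geo j) * col G) =
      geo i * col G - geo j * col G := by
    have hi := geo_mul i
    have hj := geo_mul j
    rw [map_sub, mapC_X, mapC_X]
    linear_combination (geo i * col G) * hj - (geo j * col G) * hi
  have h2 := congrArg (hCoeff 0) h1
  rwa [hCoeff_mapC_mul, h, mul_zero, map_sub, hCoeff_zero_geo_mul_col, hCoeff_zero_geo_mul_col,
    eq_comm, sub_eq_zero] at h2

end Geometric

/-! ### The exponential and -log(1 - x/w) -/

section Exponential

variable {σ τ : Type*} {A : Type*} [CommRing A] [Algebra ℚ A]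

/-- The universal case of the functional equation; in coefficients it is the factorial formula for
binomial coefficients. -/
theorem exp_subst_X_add_X :
    (PowerSeries.exp A).subst (X 0 + X 1 : MvPowerSeries (Fin 2) A) =
      (PowerSeries.exp A).subst (X 0 : MvPowerSeries (Fin 2) A) *
        (PowerSeries.exp A).subst (X 1 : MvPowerSeries (Fin 2) A) := by
  ext e
  rw [PowerSeries.coeff_subst_X_zero_add_X_one, PowerSeries.coeff_subst_X_zero_subst_mul_X_one,
    PowerSeries.coeff_exp, PowerSeries.coeff_exp, PowerSeries.coeff_exp, ← map_mul,
    ← map_natCast (algebraMap ℚ A), ← map_mul]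
  congr 1
  rw [Nat.cast_add_choose]
  have h1 : ((e 0).factorial : ℚ) ≠ 0 := by exact_mod_cast (e 0).factorial_ne_zero
  have h2 : ((e 1).factorial : ℚ) ≠ 0 := by exact_mod_cast (e 1).factorial_ne_zero
  have h3 : ((e 0 + e 1).factorial : ℚ) ≠ 0 := by exact_mod_cast (e 0 + e 1).factorial_ne_zero
  field_simp

theorem exp_subst_add {F G : MvPowerSeries τ A} (hF : constantCoeff F = 0)
    (hG : constantCoeff G = 0) :
    (PowerSeries.exp A).subst (F + G) =
      (PowerSeries.exp A).subst F * (PowerSeries.exp A).subst G := by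
  have h : HasSubst ![F, G] := hasSubst_of_constantCoeff_zero (by
    intro i
    fin_cases i <;> simp [hF, hG])
  have h01 : PowerSeries.HasSubst (X 0 + X 1 : MvPowerSeries (Fin 2) A) :=
    PowerSeries.HasSubst.of_constantCoeff_zero (by simp)
  have key := congrArg (subst ![F, G]) (exp_subst_X_add_X (A := A))
  rw [subst_mul h, PowerSeries.subst, PowerSeries.subst, PowerSeries.subst,
    subst_comp_subst_apply h01.const h, subst_comp_subst_apply (PowerSeries.HasSubst.X _).const h,
    subst_comp_subst_apply (PowerSeries.HasSubst.X _).const h, subst_add h, subst_X h,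
    subst_X h] at key
  exact key

theorem exp_subst_zero : (PowerSeries.exp A).subst (0 : MvPowerSeries τ A) = 1 := by
  rw [PowerSeries.subst_zero_eq_C_constantCoeff]
  simp

theorem charZero_K : CharZero K := algebraRat.charZero K

theorem finsum_eq_finsum_comp {α ι M : Type*} [AddCommMonoid M] {f : ι → α}
    (hf : Function.Injective f) (g : α → M) (h : ∀ x, x ∉ Set.range f → g x = 0) :
    ∑ᶠ x, g x = ∑ᶠ i, g (f i) := by
  rw [← finsum_mem_univ, ← finsum_mem_range (f := g) hf]
  refine finsum_mem_inter_support_eq g _ _ ?_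
  rw [Set.univ_inter, eq_comm, Set.inter_eq_right]
  intro x hx
  by_contra hr
  exact hx (h x hr)

/-- The series `-log(1 - X)`. -/
def negLog : PowerSeries K := PowerSeries.mk fun n => ((n : ℕ) : K)⁻¹

/-- The product has derivative zero, since (1 - X) is inverse to the derivative of `negLog`, and it
has constant term 1. -/
theorem exp_subst_negLog : (PowerSeries.exp K).subst negLog * (1 - PowerSeries.X) = 1 := by
  have h0 : PowerSeries.constantCoeff negLog = 0 := by
    rw [← PowerSeries.coeff_zero_eq_constantCoeff_apply, negLog, PowerSeries.coeff_mk]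
    simp
  have hs : PowerSeries.HasSubst negLog := PowerSeries.HasSubst.of_constantCoeff_zero' h0
  have : IsAddTorsionFree K := by
    have := charZero_K
    infer_instance
  have hd : PowerSeries.derivative K negLog * (1 - PowerSeries.X) = 1 := by
    refine Eq.trans ?_ (PowerSeries.mk_one_mul_one_sub_eq_one K)
    refine congrArg (· * (1 - PowerSeries.X)) ?_
    ext n
    rw [PowerSeries.coeff_derivative, negLog, PowerSeries.coeff_mk, PowerSeries.coeff_mk]
    have : ((n : K) + 1) ≠ 0 := by
      have := charZero_K
      exact Nat.cast_add_one_ne_zero n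
    push_cast
    rw [Pi.one_apply]
    field_simp
  refine PowerSeries.derivative.ext ?_ ?_
  · rw [Derivation.leibniz, PowerSeries.derivative_subst hs, PowerSeries.derivative_exp,
      smul_eq_mul, smul_eq_mul, map_sub, PowerSeries.derivative_X, PowerSeries.derivative_one]
    linear_combination ((PowerSeries.exp K).subst negLog) * hd
  · have h1 := PowerSeries.constantCoeff_subst_eq_zero (a := negLog) h0 (PowerSeries.exp K - 1)
      (by simp)
    have h2 : (1 : PowerSeries K).subst negLog = (1 : PowerSeries K) := by
      rw [← PowerSeries.coe_substAlgHom hs, map_one]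
    rw [PowerSeries.subst_sub hs, h2, map_sub, sub_eq_zero] at h1
    rw [map_mul]
    have h3 : PowerSeries.constantCoeff ((PowerSeries.exp K).subst negLog) = 1 := by
      refine Eq.trans ?_ (h1.trans (map_one _))
      rfl
    rw [h3]
    simp

/-- The monomial `X i / w`. -/
def quot (i : τ) : MvPowerSeries τ K := C (HahnSeries.single (-1 : ℤ) (1 : ℂ)) * X i

theorem hasSubst_quot (i : τ) : PowerSeries.HasSubst (quot i) :=
  PowerSeries.HasSubst.of_constantCoeff_zero (by simp [quot])

theorem exp_subst_negLog_quot (i : τ) :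
    (PowerSeries.exp K).subst (negLog.subst (quot i)) = geo i := by
  have hn : PowerSeries.HasSubst negLog := PowerSeries.HasSubst.of_constantCoeff_zero' (by
    rw [← PowerSeries.coeff_zero_eq_constantCoeff_apply, negLog, PowerSeries.coeff_mk]
    simp)
  have h := congrArg (PowerSeries.subst (quot i)) exp_subst_negLog
  have h1 : (1 : PowerSeries K).subst (quot i) = 1 := by
    rw [← PowerSeries.coe_substAlgHom (hasSubst_quot i), map_one]
  rw [PowerSeries.subst_mul (hasSubst_quot i), PowerSeries.subst_sub (hasSubst_quot i), h1,
    PowerSeries.subst_X (hasSubst_quot i),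
    PowerSeries.subst_comp_subst_apply hn (hasSubst_quot i)] at h
  have hg : geo i * (1 - quot i) = 1 := geo_mul i
  linear_combination geo i * h - (PowerSeries.exp K).subst (negLog.subst (quot i)) * hg

open Classical in
theorem coeff_negLog_quot (i : τ) (d : τ →₀ ℕ) :
    coeff d (negLog.subst (quot i)) = ∑ᶠ k : ℕ+,
      HahnSeries.single (-1 : ℤ) (1 : ℂ) ^ (k : ℕ) *
        coeff d (mapC (C (1 / ((k : ℕ) : ℂ)) * X i ^ (k : ℕ))) := by
  rw [PowerSeries.coeff_subst (hasSubst_quot i)]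
  have hterm : ∀ n : ℕ, PowerSeries.coeff n negLog • coeff d (quot i ^ n) =
      HahnSeries.single (-1 : ℤ) (1 : ℂ) ^ n *
        coeff d (mapC (C (1 / (n : ℂ)) * X i ^ n)) := by
    intro n
    rw [negLog, PowerSeries.coeff_mk, quot, mul_pow, ← map_pow C, coeff_C_mul, map_mul mapC,
      map_pow mapC, mapC_X]
    have : mapC (C (1 / (n : ℂ)) : MvPowerSeries τ ℂ) = C ((n : K)⁻¹) := by
      rw [mapC, map_C, one_div, map_inv₀, map_natCast]
    rw [this, coeff_C_mul, smul_eq_mul]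
    ring
  simp_rw [hterm]
  refine finsum_eq_finsum_comp PNat.coe_injective _ fun n hn => ?_
  -- Only n = 0 lies outside the range, and its term vanishes because `1 / 0 = 0`.
  have : n = 0 := by
    by_contra h
    exact hn ⟨⟨n, Nat.pos_of_ne_zero h⟩, rfl⟩
  subst this
  simp

end Exponential

/-! ### The exponential factors under substitution -/

section Phase

variable {τ : Type*}

theorem z_zero_zpow (n : ℤ) : z 0 ^ n = HahnSeries.single (-n) (1 : ℂ) := by
  have h : (HahnSeries.single (-1 : ℤ) (1 : ℂ)) = (HahnSeries.single (1 : ℤ) (1 : ℂ))⁻¹ := by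
    rw [HahnSeries.inv_single, inv_one]
  rw [z, if_pos rfl, h, inv_zpow', ← RatFunc.single_zpow]

theorem z_one_zpow (n : ℤ) : z 1 ^ n = HahnSeries.single n (1 : ℂ) := by
  rw [z, if_neg (by decide), ← RatFunc.single_zpow]

/-- In terms of w both phases are ξ(t^{(a)}, w⁻¹), so the two components can be treated together. -/
theorem phase_eq (a : Fin 2) : phase a = xi a (HahnSeries.single (-1 : ℤ) (1 : ℂ)) := by
  have h0 := z_zero_zpow 1
  have h1 := z_one_zpow (-1)
  rw [zpow_one] at h0
  rw [zpow_neg_one] at h1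
  fin_cases a
  · simp [phase, h0]
  · simp [phase, h1]

theorem coeff_single_xi (a : Fin 2) (x : K) (k : ℕ+) :
    coeff (Finsupp.single (a, k) 1) (xi a x) = x ^ (k : ℕ) := by
  change (∑ᶠ l : ℕ+, if (Finsupp.single (a, k) 1 : Time →₀ ℕ) = Finsupp.single (a, l) 1
    then x ^ (l : ℕ) else 0) = _
  rw [finsum_eq_single _ k, if_pos rfl]
  intro l hl
  rw [if_neg]
  intro h
  have h2 := Finsupp.single_left_injective one_ne_zero h
  exact hl (Prod.ext_iff.1 h2).2.symm

theorem coeff_subst_xi {ψ : Time → MvPowerSeries τ K} (hψ : HasSubst ψ) (a : Fin 2) (x : K)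
    (e : τ →₀ ℕ) :
    coeff e (subst ψ (xi a x)) = ∑ᶠ k : ℕ+, x ^ (k : ℕ) * coeff e (ψ (a, k)) := by
  rw [coeff_subst hψ]
  have hinj : Function.Injective fun k : ℕ+ => (Finsupp.single (a, k) 1 : Time →₀ ℕ) := by
    intro k l h
    exact (Prod.ext_iff.1 (Finsupp.single_left_injective one_ne_zero h)).2
  rw [finsum_eq_finsum_comp hinj]
  · refine finsum_congr fun k => ?_
    rw [coeff_single_xi, Finsupp.prod_single_index (by simp), pow_one, smul_eq_mul]
  · intro d hd
    have : coeff d (xi a x) = 0 := by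
      refine finsum_eq_zero_of_forall_eq_zero fun k => ?_
      rw [if_neg]
      rintro rfl
      exact hd ⟨k, rfl⟩
    rw [this, smul_eq_mul, zero_mul]

theorem constantCoeff_xi (a : Fin 2) (x : K) : constantCoeff (xi a x) = 0 := by
  rw [← coeff_zero_eq_constantCoeff_apply]
  refine finsum_eq_zero_of_forall_eq_zero fun k => ?_
  rw [if_neg]
  intro h
  have := DFunLike.congr_fun h (a, k)
  simp at this

theorem subst_expW {ψ : Time → MvPowerSeries τ K} (hψ : HasSubst ψ) {F : Wave}
    (hF : constantCoeff F = 0) :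
    subst ψ (expW F) = (PowerSeries.exp K).subst (subst ψ F) := by
  rw [expW, PowerSeries.subst, PowerSeries.subst,
    subst_comp_subst_apply (PowerSeries.HasSubst.of_constantCoeff_zero hF).const hψ]

/-- The effect on the exponential factors of `t' = t - [x]_a - [y]_b`. -/
theorem subst_expW_mul_subst_expW_neg {ψ φ : Time → MvPowerSeries τ K} (hψ : HasSubst ψ)
    (hφ : HasSubst φ) (hψ0 : ∀ i, constantCoeff (ψ i) = 0) (hφ0 : ∀ i, constantCoeff (φ i) = 0)
    (a b c : Fin 2) (x y : τ)
    (h : ∀ k : ℕ+, ψ (c, k) = φ (c, k) +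
      (if c = a then mapC (C (1 / ((k : ℕ) : ℂ)) * X x ^ (k : ℕ)) else 0) +
      (if c = b then mapC (C (1 / ((k : ℕ) : ℂ)) * X y ^ (k : ℕ)) else 0)) :
    subst ψ (expW (phase c)) * subst φ (expW (-phase c)) =
      (if c = a then geo x else 1) * (if c = b then geo y else 1) := by
  classical
  let v : K := HahnSeries.single (-1 : ℤ) (1 : ℂ)
  have hp0 : constantCoeff (phase c) = 0 := by rw [phase_eq, constantCoeff_xi]
  have hneg : subst φ (-phase c) = -subst φ (phase c) := by
    simp only [← substAlgHom_apply (R := K) hφ, map_neg]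
  have hsum : subst ψ (phase c) = subst φ (phase c) +
      (if c = a then negLog.subst (quot x) else 0) +
      (if c = b then negLog.subst (quot y) else 0) := by
    ext1 e
    -- For a fixed exponent only finitely many times contribute, which permits splitting the sum
    -- over k.
    have fin1 : (fun k : ℕ+ => v ^ (k : ℕ) * coeff e (φ (c, k))).HasFiniteSupport := by
      refine ((hφ.coeff_zero e).preimage (f := fun k : ℕ+ => ((c, k) : Time)) ?_).subset ?_
      · intro k _ l _ hkl
        exact (Prod.ext_iff.1 hkl).2
      · intro k hk hk0
        exact hk (by simp only [hk0, mul_zero])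
    have fin2 : ∀ (p : Prop) [Decidable p] (x : τ), (fun k : ℕ+ => v ^ (k : ℕ) *
        coeff e (if p then mapC (C (1 / ((k : ℕ) : ℂ)) * X x ^ (k : ℕ)) else 0)).HasFiniteSupport :=
        by
      intro p _ x
      refine ((Set.finite_singleton (e x)).preimage (f := fun k : ℕ+ => (k : ℕ))
        PNat.coe_injective.injOn).subset ?_
      intro k hk
      by_contra hne
      apply hk
      simp only
      split_ifs
      · rw [coeff_mapC, coeff_C_mul, coeff_X_pow, if_neg, mul_zero, map_zero, mul_zero]
        rintro rfl
        exact hne (by simp)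
      · simp
    have e2 : ∀ (p : Prop) [Decidable p] (x : τ),
        coeff e (if p then negLog.subst (quot x) else 0 : MvPowerSeries τ K) =
        ∑ᶠ k : ℕ+, v ^ (k : ℕ) *
          coeff e (if p then mapC (C (1 / ((k : ℕ) : ℂ)) * X x ^ (k : ℕ)) else 0) := by
      intro p _ x
      split_ifs
      · exact coeff_negLog_quot x e
      · simp
    rw [map_add, map_add, phase_eq, coeff_subst_xi hψ, coeff_subst_xi hφ, e2, e2,
      ← finsum_add_distrib fin1 (fin2 _ x)]
    refine Eq.trans ?_ (finsum_add_distrib (fin1.add (fin2 _ x)) (fin2 _ y))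
    refine finsum_congr fun k => ?_
    rw [h, map_add, map_add, mul_add, mul_add]
  have c0 : constantCoeff (subst φ (phase c)) = 0 :=
    constantCoeff_subst_eq_zero hφ hφ0 hp0
  have cl : ∀ (p : Prop) [Decidable p] (x : τ),
      constantCoeff (if p then negLog.subst (quot x) else 0 : MvPowerSeries τ K) = 0 := by
    intro p _ x
    split_ifs
    · refine PowerSeries.constantCoeff_subst_eq_zero (by simp [quot]) _ ?_
      rw [← PowerSeries.coeff_zero_eq_constantCoeff_apply, negLog, PowerSeries.coeff_mk]
      simp
    · simp
  rw [subst_expW hψ hp0, subst_expW hφ (by rw [map_neg, hp0, neg_zero]), hneg, ← exp_subst_add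
    (constantCoeff_subst_eq_zero hψ hψ0 hp0) (by rw [map_neg, c0, neg_zero]), hsum]
  have e3 : ∀ A B D : MvPowerSeries τ K, A + B + D + -A = B + D := fun A B D => by ring
  rw [e3, exp_subst_add (cl _ _) (cl _ _)]
  congr 1
  · split_ifs
    · exact exp_subst_negLog_quot x
    · exact exp_subst_zero
  · split_ifs
    · exact exp_subst_negLog_quot y
    · exact exp_subst_zero

end Phase

/-! ### Products in two sets of times -/

section Outer

theorem outer_mul (F F' G G' : Wave) : outer (F * F') (G * G') = outer F G * outer F' G' := by
  simp only [outer, map_mul]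
  ring

theorem outer_C (x y : K) : outer (C x) (C y) = C (x * y) := by
  simp only [outer, rename_C, map_mul]

theorem subst_outer {τ : Type*} {θ : Time ⊕ Time → MvPowerSeries τ K} (hθ : HasSubst θ)
    (F G : Wave) :
    subst θ (outer F G) = subst (fun i => θ (Sum.inl i)) F * subst (fun i => θ (Sum.inr i)) G := by
  rw [outer, subst_mul hθ, rename_eq_subst, rename_eq_subst,
    subst_comp_subst_apply (HasSubst.X_comp _) hθ, subst_comp_subst_apply (HasSubst.X_comp _) hθ]
  congr 2
  · funext i
    exact subst_X hθ _
  · funext i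
    exact subst_X hθ _

theorem res_eq_hCoeff (a : Fin 2) (Q : MvPowerSeries (Time ⊕ Time) K) :
    res a Q = hCoeff (if a = 0 then 1 else -1) Q := rfl

end Outer

theorem constantCoeff_mapC_eq_zero {τ : Type*} {F : MvPowerSeries τ ℂ}
    (hF : constantCoeff F = 0) : constantCoeff (mapC F) = 0 := by
  rw [← coeff_zero_eq_constantCoeff_apply, coeff_mapC, coeff_zero_eq_constantCoeff_apply, hF,
    map_zero]

/-! ### The substitution t' = t - [x]_a - [y]_b -/

section DoubleShift

/-- The variables `t - [x]_a - [y]_b`, where `x = X (some none)` and `y = X none`. -/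
def dshift (a b : Fin 2) (i : Time) : MvPowerSeries (Option (Option Time)) ℂ :=
  sh (-1) (optLabel (label b)) (gshift (-1) (label a) i)

theorem hasSubst_dshift (a b : Fin 2) : HasSubst (dshift a b) := by
  have h := (hasSubst_gshift (-1) (injLabel_label a)).comp
    (hasSubst_gshift (-1) (injLabel_label b).optLabel)
  simp only [coe_substAlgHom] at h
  exact h

theorem constantCoeff_dshift (a b : Fin 2) (i : Time) : constantCoeff (dshift a b i) = 0 := by
  rw [dshift, constantCoeff_sh _ (injLabel_label b).optLabel, constantCoeff_gshift]

theorem X_eq_dshift_add (a b c : Fin 2) (k : ℕ+) :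
    (X (some (some (c, k))) : MvPowerSeries (Option (Option Time)) ℂ) = dshift a b (c, k) +
      (if c = a then C (1 / ((k : ℕ) : ℂ)) * X (some none) ^ (k : ℕ) else 0) +
      (if c = b then C (1 / ((k : ℕ) : ℂ)) * X none ^ (k : ℕ) else 0) := by
  have h := hasSubst_gshift (-1) (injLabel_label b).optLabel
  have h1 : ∀ o : Option Time, gshift (-1) (optLabel (label b)) o = X (some o) +
      (o.bind (label b)).elim 0 fun k => C (-1 / ((k : ℕ) : ℂ)) * X none ^ (k : ℕ) := fun _ => rfl
  have hn : (C (-1 / ((k : ℕ) : ℂ)) : MvPowerSeries (Option (Option Time)) ℂ) =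
      -C (1 / ((k : ℕ) : ℂ)) := by rw [neg_div, map_neg]
  rw [dshift, sh, gshift, subst_add h, subst_X h, h1, Option.bind_some, label, label]
  dsimp only
  split_ifs <;>
    simp only [Option.elim_some, Option.elim_none, subst_mul h,
      subst_C, subst_pow h, subst_X h, subst_zero, h1, Option.bind_none, hn] <;>
    ring

/-- The substitution `t' = t - [x]_a - [y]_b` in a series in `t` and `t'`. -/
def dsubst (a b : Fin 2) : Time ⊕ Time → MvPowerSeries (Option (Option Time)) ℂ :=
  Sum.elim (fun i => X (some (some i))) (dshift a b)

theorem hasSubst_X_some_some :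
    HasSubst (fun i : Time => (X (some (some i)) : MvPowerSeries (Option (Option Time)) ℂ)) :=
  hasSubst_X_comp (f := fun i : Time => some (some i)) fun i j h => by simpa using h

theorem hasSubst_dsubst (a b : Fin 2) : HasSubst (dsubst a b) := by
  have h1 := hasSubst_X_some_some
  constructor
  · rintro (i | i)
    · exact h1.const_coeff i
    · exact (hasSubst_dshift a b).const_coeff i
  · intro d
    refine (((h1.coeff_zero d).image Sum.inl).union
      (((hasSubst_dshift a b).coeff_zero d).image Sum.inr)).subset ?_
    rintro (i | i) hi
    · exact Or.inl ⟨i, hi, rfl⟩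
    · exact Or.inr ⟨i, hi, rfl⟩

/-- `F(t, w)` as a series in `t`, `x`, `y` and `w`. -/
def withW (c : Time → MvPowerSeries (Option (Option Time)) ℂ)
    (F : MvPowerSeries (Option Time) ℂ) : MvPowerSeries (Option (Option (Option Time))) ℂ :=
  subst (fun o : Option Time => o.elim (X none) fun i => inc (c i)) F

theorem evw_withW (o : Option (Option Time)) {c : Time → MvPowerSeries (Option (Option Time)) ℂ}
    (hc : HasSubst c) (F : MvPowerSeries (Option Time) ℂ) :
    evw o (withW c F) = subst (fun j : Option Time => j.elim (X o) c) F := by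
  rw [evw, withW, subst_comp_subst_apply (hasSubst_inc_comp hc) (hasSubst_evw o)]
  congr 1
  funext j
  rcases j with _ | i
  · exact subst_X (hasSubst_evw o) none
  · have h : (X : Option (Option Time) → MvPowerSeries (Option (Option Time)) ℂ) =
        fun i => subst (fun p : Option (Option (Option Time)) => p.elim (X o) X)
          (X (some i) : MvPowerSeries (Option (Option (Option Time))) ℂ) := by
      funext i
      rw [subst_X (hasSubst_evw o), Option.elim_some]
    simp only [Option.elim_some, inc]
    rw [subst_comp_subst_apply hasSubst_inc (hasSubst_evw o), ← h, subst_self, id]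

theorem evw_some_none_withW_X (F : MvPowerSeries (Option Time) ℂ) :
    evw (some none) (withW (fun i => X (some (some i))) F) = inc F := by
  rw [evw_withW _ hasSubst_X_some_some, inc]
  congr 1
  funext o
  rcases o with _ | i <;> rfl

/-- A translation by zero ignores its labels, so `κ` is left free to match the form of `IsCocycle`.
-/
theorem evw_none_withW_X (κ : Time → Option ℕ+) (F : MvPowerSeries (Option Time) ℂ) :
    evw none (withW (fun i => X (some (some i))) F) = lsh 0 κ F := by
  rw [evw_withW _ hasSubst_X_some_some, lsh]
  congr 1
  funext o
  rcases o with _ | i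
  · rfl
  · simp only [Option.elim_some, gshift_zero, inc, subst_X hasSubst_inc]

theorem evw_some_none_withW_dshift (a b : Fin 2) (F : MvPowerSeries (Option Time) ℂ) :
    evw (some none) (withW (dshift a b) F) =
      sh (-1) (optLabel (label b)) (shA (-1) (label a) F) := by
  have h := hasSubst_gshift (-1) (injLabel_label b).optLabel
  rw [evw_withW _ (hasSubst_dshift a b), sh, shA,
    subst_comp_subst_apply (hasSubst_shA _ (injLabel_label a)) h]
  congr 1
  funext o
  rcases o with _ | i
  · simp [subst_X h, gshift, optLabel]
  · rfl

theorem evw_none_withW_dshift (a b : Fin 2) (F : MvPowerSeries (Option Time) ℂ) :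
    evw none (withW (dshift a b) F) = lsh (-1) (label a) (shA (-1) (label b) F) := by
  have ha := injLabel_label a
  have hb := injLabel_label b
  rw [evw_withW _ (hasSubst_dshift a b), ← shA_optLabel_lsh _ _ ha hb, shA, lsh,
    subst_comp_subst_apply (hasSubst_lsh _ ha) (hasSubst_shA _ hb.optLabel)]
  congr 1
  funext o
  rcases o with _ | i
  · simp [subst_X (hasSubst_shA (-1) hb.optLabel)]
  · exact (shA_inc (-1) hb.optLabel _).symm

/-- The integrand of the bilinear equation, after the substitution `t' = t - [x]_a - [y]_b`. -/
theorem subst_integrand (a b c : Fin 2) (u : K) (F G : MvPowerSeries (Option Time) ℂ) :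
    subst (fun i => mapC (dsubst a b i))
      (C u * outer (expW (phase c)) (expW (-phase c)) * outer (col F) (col G)) =
      C u * ((if c = a then geo (some none) else 1) * (if c = b then geo none else 1)) *
        col (withW (fun i => X (some (some i))) F * withW (dshift a b) G) := by
  have h : HasSubst (fun i => mapC (dsubst a b i)) :=
    (hasSubst_dsubst a b).map (S := K) (HahnSeries.C : ℂ →+* K)
  have h1 : HasSubst (fun i : Time => mapC
      (X (some (some i)) : MvPowerSeries (Option (Option Time)) ℂ)) :=
    hasSubst_X_some_some.map (S := K) (HahnSeries.C : ℂ →+* K)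
  have h2 : HasSubst (fun i : Time => mapC (dshift a b i)) :=
    (hasSubst_dshift a b).map (S := K) (HahnSeries.C : ℂ →+* K)
  rw [subst_mul h, subst_mul h, subst_C, subst_outer h, subst_outer h]
  simp only [dsubst, Sum.elim_inl, Sum.elim_inr]
  rw [subst_expW_mul_subst_expW_neg h1 h2 (fun i => constantCoeff_mapC_eq_zero (by simp))
    (fun i => constantCoeff_mapC_eq_zero (constantCoeff_dshift a b i)) a b c (some none) none,
    subst_mapC_col hasSubst_X_some_some, subst_mapC_col (hasSubst_dshift a b), map_mul]
  · rfl
  · intro k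
    rw [X_eq_dshift_add a b c k, map_add, map_add]
    split_ifs <;> simp

end DoubleShift

/-! ### Residues of the bilinear equation -/

section Bilinear

/-- The bilinear equation, for `Ψ_a(m,t,z) = z^{m_a} e^ξ P_a(m,t,w)` and
`Ψ̃_a(m,t,z) = z^{-m_a+1} e^{-ξ} Q_a(m,t,w)`. -/
def IsBilinear (P Q : Fin 2 → ℤ × ℤ → MvPowerSeries (Option Time) ℂ) : Prop :=
  ∀ m m' : ℤ × ℤ, m'.1 - m'.2 ≤ m.1 - m.2 →
    hCoeff 0 (C (HahnSeries.single (m'.1 - m.1 - 1) (1 : ℂ)) *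
        outer (expW (phase 0)) (expW (-phase 0)) * outer (col (P 0 m)) (col (Q 0 m'))) =
      hCoeff 0 (C (HahnSeries.single (m.2 - m'.2 + 1) (1 : ℂ)) *
        outer (expW (phase 1)) (expW (-phase 1)) * outer (col (P 1 m)) (col (Q 1 m')))

/-- The lattice shift of `τ` in the numerator of `Ψ_a`. -/
def latticeShift (a : Fin 2) : ℤ × ℤ := if a = 0 then 0 else (1, 1)

variable {P Q : Fin 2 → ℤ × ℤ → MvPowerSeries (Option Time) ℂ}

theorem IsBilinear.subst (h : IsBilinear P Q) (a b : Fin 2) {m m' : ℤ × ℤ}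
    (hm : m'.1 - m'.2 ≤ m.1 - m.2) :
    hCoeff 0 (C (HahnSeries.single (m'.1 - m.1 - 1) (1 : ℂ)) *
      ((if 0 = a then geo (some none) else 1) * (if 0 = b then geo none else 1)) *
        col (withW (fun i => X (some (some i))) (P 0 m) * withW (dshift a b) (Q 0 m'))) =
    hCoeff 0 (C (HahnSeries.single (m.2 - m'.2 + 1) (1 : ℂ)) *
      ((if 1 = a then geo (some none) else 1) * (if 1 = b then geo none else 1)) *
        col (withW (fun i => X (some (some i))) (P 1 m) * withW (dshift a b) (Q 1 m'))) := by
  have h1 := congrArg (MvPowerSeries.subst (dsubst a b)) (h m m' hm)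
  rwa [← hCoeff_subst_mapC (hasSubst_dsubst a b), ← hCoeff_subst_mapC (hasSubst_dsubst a b),
    subst_integrand, subst_integrand] at h1

/-- The choice of m' fixes the power of w. For a ≠ b it is w^0 on both sides, and each residue has a
single pole factor. For a = b the component a carries w^{-1} with both pole factors, and the other
carries w times a power series in w, which contributes nothing. -/
theorem IsBilinear.evw_eq (h : IsBilinear P Q) (a b : Fin 2) (m : ℤ × ℤ) :
    evw (some none) (withW (fun i => X (some (some i))) (P a m) *
      withW (dshift a b) (Q a (m + latticeShift a + latticeShift b))) =
    evw none (withW (fun i => X (some (some i))) (P b m) *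
      withW (dshift a b) (Q b (m + latticeShift a + latticeShift b))) := by
  -- Both lattice shifts preserve m₁ - m₂, so the constraint holds with equality.
  have h1 := h.subst a b (m := m) (m' := m + latticeShift a + latticeShift b) (by
    unfold latticeShift
    split_ifs <;> simp)
  obtain ⟨m₁, m₂⟩ := m
  have z1 : (HahnSeries.single (0 : ℤ) (1 : ℂ)) = (1 : K) := rfl
  fin_cases a <;> fin_cases b
  · refine hCoeff_geo_mul_geo_mul_col _ ?_
    simpa [-map_mul, latticeShift, hCoeff_C_single_mul, hCoeff_neg_col] using h1
  · have e : m₂ - (m₂ + 1) + 1 = 0 := by ring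
    simpa [-map_mul, latticeShift, e, z1, hCoeff_zero_geo_mul_col] using h1
  · have e : m₂ - (m₂ + 1) + 1 = 0 := by ring
    simpa [-map_mul, latticeShift, e, z1, hCoeff_zero_geo_mul_col] using h1.symm
  · refine hCoeff_geo_mul_geo_mul_col _ ?_
    have e : m₂ - (m₂ + 1 + 1) + 1 = -1 := by ring
    have e' : m₁ + 1 + 1 - m₁ - 1 = 1 := by ring
    simpa [-map_mul, latticeShift, e, e', hCoeff_C_single_mul, hCoeff_neg_col] using h1.symm

/-- The consequence of the bilinear equation at `t' = t - [x]_a - [y]_b`. -/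
theorem IsBilinear.double_shift (h : IsBilinear P Q) (a b : Fin 2) (m : ℤ × ℤ) :
    inc (P a m) * sh (-1) (optLabel (label b))
      (shA (-1) (label a) (Q a (m + latticeShift a + latticeShift b))) =
    lsh 0 (label a) (P b m) * lsh (-1) (label a)
      (shA (-1) (label b) (Q b (m + latticeShift a + latticeShift b))) := by
  have h1 := h.evw_eq a b m
  have e : ∀ (o : Option (Option Time)) F G, evw o (F * G) = evw o F * evw o G :=
    fun o F G => subst_mul (hasSubst_evw o) F G
  rwa [e, e, evw_some_none_withW_X, evw_none_withW_X (label a), evw_some_none_withW_dshift,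
    evw_none_withW_dshift] at h1

end Bilinear

/-! ### Setting x or y to zero -/

section Specialization

variable {τ : Type*}

theorem hasSubst_elim_zero :
    HasSubst (fun o : Option τ => o.elim 0 (X : τ → MvPowerSeries τ ℂ)) :=
  hasSubst_option HasSubst.X (by simp)

theorem subst_elim_zero_sh (ε : ℂ) {κ : τ → Option ℕ+} (hκ : InjLabel κ)
    (F : MvPowerSeries τ ℂ) :
    subst (fun o : Option τ => o.elim 0 (X : τ → MvPowerSeries τ ℂ)) (sh ε κ F) = F := by
  have h := hasSubst_elim_zero (τ := τ)
  rw [sh, subst_comp_subst_apply (hasSubst_gshift ε hκ) h]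
  have : (fun i => subst (fun o : Option τ => o.elim 0 (X : τ → MvPowerSeries τ ℂ))
      (gshift ε κ i)) = X := by
    funext i
    rw [gshift, subst_add h, subst_X h]
    rcases κ i with _ | k
    · simp [subst_zero]
    · simp [subst_mul h, subst_pow h, subst_X h]
  rw [this, subst_self, id]

theorem subst_elim_zero_inc (F : MvPowerSeries τ ℂ) :
    subst (fun o : Option τ => o.elim 0 (X : τ → MvPowerSeries τ ℂ)) (inc F) = F := by
  rw [← sh_zero (fun _ => none), subst_elim_zero_sh]
  intro i j k hi
  cases hi

/-- A substitution for which the image of `w` vanishes sends series with leading term `1`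
to `1`. -/
theorem subst_eq_one_of_dvd {σ υ : Type*} {a : Option σ → MvPowerSeries υ ℂ} (ha : HasSubst a)
    (h0 : a none = 0) {F : MvPowerSeries (Option σ) ℂ} (hF : X none ∣ F - 1) :
    subst a F = 1 := by
  obtain ⟨G, hG⟩ := hF
  rw [eq_add_of_sub_eq hG, subst_add ha, subst_mul ha, subst_X ha, h0, zero_mul, zero_add,
    subst_one]

theorem X_none_dvd_shA_sub_one (ε : ℂ) {κ : τ → Option ℕ+} (hκ : InjLabel κ)
    {F : MvPowerSeries (Option τ) ℂ} (hF : X none ∣ F - 1) : X none ∣ shA ε κ F - 1 := by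
  obtain ⟨G, hG⟩ := hF
  have h := hasSubst_shA ε hκ
  refine ⟨shA ε κ G, ?_⟩
  rw [eq_add_of_sub_eq hG, shA, subst_add h, subst_mul h, subst_X h, subst_one, shA]
  simp

theorem X_none_dvd_sub_one {F : MvPowerSeries (Option τ) ℂ} (hF : wCoeff 0 F = 1) :
    X none ∣ F - 1 := by
  have h : PowerSeries.X ∣ optionEquivLeft τ ℂ (F - 1) := by
    rw [PowerSeries.X_dvd_iff, ← PowerSeries.coeff_zero_eq_constantCoeff_apply, map_sub, map_sub,
      map_one, PowerSeries.coeff_zero_one, sub_eq_zero]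
    exact hF
  obtain ⟨G, hG⟩ := h
  refine ⟨(optionEquivLeft τ ℂ).symm G, (optionEquivLeft τ ℂ).injective ?_⟩
  rw [hG, map_mul, optionEquivLeft_X_none, AlgEquiv.apply_symm_apply]

/-- The substitution `x = 0` in a series in `t`, `x = X (some none)` and `y = X none`. -/
def killX (F : MvPowerSeries (Option (Option τ)) ℂ) : MvPowerSeries (Option τ) ℂ :=
  subst (fun o : Option (Option τ) => o.elim (X none) fun p => p.elim 0 fun i => X (some i)) F

theorem hasSubst_killX : HasSubst (fun o : Option (Option τ) =>
    o.elim (X none) fun p => p.elim 0 fun i => (X (some i) : MvPowerSeries (Option τ) ℂ)) :=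
  hasSubst_option (hasSubst_option hasSubst_inc (by simp)) (by simp)

theorem killX_lsh (ε : ℂ) {κ : τ → Option ℕ+} (hκ : InjLabel κ)
    (F : MvPowerSeries (Option τ) ℂ) : killX (lsh ε κ F) = F := by
  have h := hasSubst_killX (τ := τ)
  rw [killX, lsh, subst_comp_subst_apply (hasSubst_lsh ε hκ) h]
  have : (fun o : Option τ => subst (fun o : Option (Option τ) => o.elim (X none) fun p =>
      p.elim 0 fun i => (X (some i) : MvPowerSeries (Option τ) ℂ))
      (o.elim (X none) fun i => inc (gshift ε κ i))) = X := by
    funext o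
    rcases o with _ | i
    · simp [subst_X h]
    · have h2 : HasSubst (fun p : Option τ => p.elim 0 fun i =>
          (X (some i) : MvPowerSeries (Option τ) ℂ)) := hasSubst_option hasSubst_inc (by simp)
      rw [Option.elim_some, inc, subst_comp_subst_apply hasSubst_inc h]
      simp only [subst_X h, Option.elim_some]
      rw [gshift, subst_add h2, subst_X h2]
      rcases κ i with _ | k
      · simp [subst_zero]
      · simp [subst_mul h2, subst_pow h2, subst_X h2]
  rw [this, subst_self, id]

theorem killX_inc {F : MvPowerSeries (Option τ) ℂ} (hF : X none ∣ F - 1) :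
    killX (inc F) = 1 := by
  have h := hasSubst_killX (τ := τ)
  rw [killX, inc, subst_comp_subst_apply hasSubst_inc h]
  refine subst_eq_one_of_dvd ?_ ?_ hF
  · simp only [subst_X h, Option.elim_some]
    exact hasSubst_option hasSubst_inc (by simp)
  · simp [subst_X h]

theorem killX_sh (ε : ℂ) {κ : τ → Option ℕ+} (hκ : InjLabel κ)
    {F : MvPowerSeries (Option τ) ℂ} (hF : X none ∣ F - 1) :
    killX (sh ε (optLabel κ) F) = 1 := by
  have h := hasSubst_killX (τ := τ)
  have hg := hasSubst_gshift ε hκ.optLabel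
  rw [killX, sh, subst_comp_subst_apply hg h]
  refine subst_eq_one_of_dvd ?_ ?_ hF
  · have := hg.comp h
    simpa only [coe_substAlgHom] using this
  · simp [gshift, optLabel, subst_X h]

end Specialization

/-! ### From the bilinear equation to tau functions -/

section Cocycle

variable {P Q : Fin 2 → ℤ × ℤ → MvPowerSeries (Option Time) ℂ}

/-- `P_a(m,t,w) Q_a(m+s_a,t-[w]_a,w) = 1`. -/
theorem IsBilinear.mul_eq_one (h : IsBilinear P Q) (hP : ∀ m, X none ∣ P 0 m - 1)
    (hQ : ∀ m, X none ∣ Q 0 m - 1) (a : Fin 2) (m : ℤ × ℤ) :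
    P a m * shA (-1) (label a) (Q a (m + latticeShift a)) = 1 := by
  have i0 := injLabel_label 0
  have i1 := injLabel_label 1
  fin_cases a
  -- With a = b = 0, set y = 0: the right side becomes 1 because P_0 and Q_0 have leading term 1.
  · have h1 := congrArg (MvPowerSeries.subst (fun o : Option (Option Time) =>
      o.elim 0 (X : Option Time → MvPowerSeries (Option Time) ℂ))) (h.double_shift 0 0 m)
    have h2 := hasSubst_elim_zero (τ := Option Time)
    have h3 : ∀ ε F, X none ∣ F - 1 → MvPowerSeries.subst (fun o : Option (Option Time) =>
        o.elim 0 (X : Option Time → MvPowerSeries (Option Time) ℂ)) (lsh ε (label 0) F) = 1 := by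
      intro ε F hF
      rw [lsh, subst_comp_subst_apply (hasSubst_lsh ε i0) h2]
      refine subst_eq_one_of_dvd ?_ ?_ hF
      · have := (hasSubst_lsh ε i0).comp h2
        simpa only [coe_substAlgHom] using this
      · simp [subst_X h2]
    have e : latticeShift 0 = 0 := rfl
    rw [subst_mul h2, subst_mul h2, subst_elim_zero_inc, subst_elim_zero_sh _ i0.optLabel,
      h3 _ _ (hP m), h3 _ _ (X_none_dvd_shA_sub_one _ i0 (hQ _)), e, add_zero, add_zero,
      mul_one] at h1
    simpa [e] using h1
  -- For the component 1 no leading term is known, so use the mixed relation and set x = 0: now the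
  -- side of the component 0 becomes 1.
  · have h1 := congrArg killX (h.double_shift 0 1 m)
    have h2 : ∀ F G : MvPowerSeries (Option (Option Time)) ℂ, killX (F * G) = killX F * killX G :=
      fun F G => subst_mul hasSubst_killX F G
    have e : latticeShift 0 = 0 := rfl
    rw [h2, h2, killX_inc (hP m), killX_sh _ i1 (X_none_dvd_shA_sub_one _ i0 (hQ _)),
      killX_lsh _ i0, killX_lsh _ i0, e, add_zero, one_mul] at h1
    exact h1.symm

/-- In `double_shift`, the inverse relation at t - [y]_b eliminates Q_a and the one at t - [x]_a
eliminates Q_b. -/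
theorem IsBilinear.isCocycle (h : IsBilinear P Q) (hP : ∀ m, X none ∣ P 0 m - 1)
    (hQ : ∀ m, X none ∣ Q 0 m - 1) : IsCocycle latticeShift P := by
  intro a b m
  have h1 := h.double_shift a b m
  have h2 := congrArg (lsh (-1) (label a)) (h.mul_eq_one hP hQ b (m + latticeShift a))
  have h3 := congrArg (sh (-1) (optLabel (label b))) (h.mul_eq_one hP hQ a (m + latticeShift b))
  rw [lsh_mul _ (injLabel_label a)] at h2
  have e2 : lsh (-1) (label a) 1 = 1 := subst_one
  have e3 : sh (-1) (optLabel (label b)) 1 = 1 := subst_one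
  have e4 : ∀ F G, sh (-1) (optLabel (label b)) (F * G) = sh (-1) (optLabel (label b)) F *
      sh (-1) (optLabel (label b)) G := fun F G =>
    subst_mul (hasSubst_gshift _ (injLabel_label b).optLabel) F G
  rw [e2] at h2
  rw [e3, e4, add_right_comm] at h3
  linear_combination (-(inc (P a m) * lsh (-1) (label a) (P b (m + latticeShift a)))) * h3 +
    (sh (-1) (optLabel (label b)) (P a (m + latticeShift b)) *
      lsh (-1) (label a) (P b (m + latticeShift a))) * h1 +
    (lsh 0 (label a) (P b m) * sh (-1) (optLabel (label b)) (P a (m + latticeShift b))) * h2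

theorem exists_int_prod (c : ℤ → ℂ) (hc : ∀ n, c n ≠ 0) :
    ∃ u : ℤ → ℂ, (∀ n, u n ≠ 0) ∧ ∀ n, u (n + 1) = u n * c n := by
  -- The solution with value 1 at zero: products of the c_i upwards, of their inverses downwards.
  refine ⟨fun n => match n with
    | Int.ofNat k => ∏ i ∈ Finset.range k, c i
    | Int.negSucc k => ∏ i ∈ Finset.range (k + 1), (c (Int.negSucc i))⁻¹, ?_, ?_⟩
  · rintro (k | k)
    · exact Finset.prod_ne_zero_iff.2 fun i _ => hc _
    · exact Finset.prod_ne_zero_iff.2 fun i _ => inv_ne_zero (hc _)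
  · rintro (k | k)
    · exact Finset.prod_range_succ _ _
    · rcases k with _ | k
      · have := hc (Int.negSucc 0)
        change ∏ i ∈ Finset.range 0, c i = (∏ i ∈ Finset.range 1, (c (Int.negSucc i))⁻¹) * _
        simpa using (inv_mul_cancel₀ this).symm
      · have e : Int.negSucc (k + 1) + 1 = Int.negSucc k := by omega
        rw [e]
        change ∏ i ∈ Finset.range (k + 1), (c (Int.negSucc i))⁻¹ =
          (∏ i ∈ Finset.range (k + 1 + 1), (c (Int.negSucc i))⁻¹) * _
        rw [Finset.prod_range_succ _ (k + 1), inv_mul_cancel_right₀ (hc _)]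

/-- The tau functions of a solution of the bilinear equation. -/
theorem IsBilinear.exists_tau (h : IsBilinear P Q) (hP : ∀ m, X none ∣ P 0 m - 1)
    (hQ : ∀ m, X none ∣ Q 0 m - 1) :
    ∃ τ : ℤ × ℤ → Fun, (∀ m, constantCoeff (τ m) ≠ 0) ∧
      (∀ a m, P a m * inc (τ m) = sh (-1) (label a) (τ (m + latticeShift a))) ∧
      ∀ a m, Q a m * inc (τ m) = sh 1 (label a) (τ (m - latticeShift a)) := by
  have hc : ∀ a m, constantCoeff (P a m) ≠ 0 := by
    intro a m h0
    have h1 := congrArg constantCoeff (h.mul_eq_one hP hQ a m)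
    rw [map_mul, h0, zero_mul, map_one] at h1
    exact zero_ne_one h1
  have hc0 : ∀ m, constantCoeff (P 0 m) = 1 := by
    intro m
    obtain ⟨G, hG⟩ := hP m
    rw [eq_add_of_sub_eq hG]
    simp
  obtain ⟨τ₀, hτ₀, hτ⟩ := (h.isCocycle hP hQ).exists_tau hc
  -- On each line m₁ - m₂ = b, with m₂ as coordinate, the rescaling must satisfy a first-order
  -- recursion whose factors are the constant terms of P_1.
  choose u hu0 hu using fun b : ℤ =>
    exists_int_prod (fun n => constantCoeff (P 1 (b + n, n))) fun n => hc _ _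
  have hu' : ∀ m : ℤ × ℤ, u ((m + (1, 1)).1 - (m + (1, 1)).2) (m + (1, 1)).2 =
      u (m.1 - m.2) m.2 * constantCoeff (P 1 m) := by
    rintro ⟨p, q⟩
    have := hu (p - q) q
    rw [sub_add_cancel] at this
    simpa using this
  let τ : ℤ × ℤ → Fun := fun m => C (u (m.1 - m.2) m.2) * τ₀ m
  have hincC : ∀ (r : ℂ) (F : Fun), inc (C r * F) = C r * inc F := fun r F => by
    rw [inc_mul, inc, subst_C]
  have hshC : ∀ (a : Fin 2) (r : ℂ) (F : Fun),
      sh (-1) (label a) (C r * F) = C r * sh (-1) (label a) F := fun a r F => by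
    rw [sh, subst_mul (hasSubst_gshift _ (injLabel_label a)), subst_C, sh]
  have key : ∀ a m, P a m * inc (τ m) = sh (-1) (label a) (τ (m + latticeShift a)) := by
    intro a m
    simp only [τ]
    rw [hincC, hshC, mul_left_comm, hτ]
    fin_cases a
    · have e : latticeShift 0 = 0 := rfl
      simp [hc0, e]
    · have e : latticeShift 1 = (1, 1) := rfl
      simp only [Fin.mk_one]
      rw [e, hu', map_mul, mul_assoc]
  refine ⟨τ, fun m => by simp [τ, hτ₀, hu0], key, fun a m => ?_⟩
  have ha := injLabel_label a
  have h1 := h.mul_eq_one hP hQ a (m - latticeShift a)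
  have h2 := key a (m - latticeShift a)
  rw [sub_add_cancel] at h1 h2
  -- The inverse relation at m - s_a solves the formula for P_a for its denominator; translating by
  -- [w]_a then isolates Q_a(m,t,w).
  have h3 : inc (τ (m - latticeShift a)) =
      shA (-1) (label a) (Q a m) * sh (-1) (label a) (τ m) := by
    linear_combination (-inc (τ (m - latticeShift a))) * h1 + shA (-1) (label a) (Q a m) * h2
  have h4 := congrArg (shA 1 (label a)) h3
  rw [shA_inc _ ha, shA_mul _ ha, shA_shA _ _ ha, shA_sh _ _ ha, add_neg_cancel, shA_zero,
    sh_zero] at h4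
  exact h4.symm

end Cocycle

/-! ### Translation to and from wave functions -/

section Waves

/-- The series `∑ c_k(t) w ^ k` as a power series in `t` and `w`. -/
def ofCoeffs (c : ℕ → Fun) : MvPowerSeries (Option Time) ℂ :=
  (optionEquivLeft Time ℂ).symm (PowerSeries.mk c)

theorem wCoeff_ofCoeffs (c : ℕ → Fun) (n : ℕ) : wCoeff n (ofCoeffs c) = c n := by
  rw [wCoeff, ofCoeffs, AlgEquiv.apply_symm_apply, PowerSeries.coeff_mk]

theorem col_ofCoeffs (c : ℕ → Fun) : col (ofCoeffs c) = expansion c := by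
  ext1 d
  rw [coeff_col]
  simp only [wCoeff_ofCoeffs]
  rfl

theorem shift_eq_col (ε : ℂ) (a : Fin 2) (f : Fun) : shift ε a f = col (sh ε (label a) f) := by
  rw [shift, collect_eq_col, sh]
  congr 2
  funext i
  rw [shiftVar, gshift, label]
  split_ifs <;> rfl

theorem hCoeff_eq_hCoeff_zero {τ : Type*} (n : ℤ) (F : MvPowerSeries τ K) :
    hCoeff n F = hCoeff 0 (C (HahnSeries.single (-n) (1 : ℂ)) * F) := by
  rw [hCoeff_C_single_mul, zero_sub, neg_neg]

/-- The coefficient of z⁻¹ is that of w^1 or w^{-1}; a further power of w moves it to degree zero,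
and all powers are collected in w^n. -/
theorem res_outer_waves (a : Fin 2) (x y : K) (n : ℤ) (E E' F G : Wave)
    (h : HahnSeries.single (-(if a = 0 then 1 else -1) : ℤ) (1 : ℂ) * (z a)⁻¹ * (x * y) =
      HahnSeries.single n 1) :
    res a (C (z a)⁻¹ * outer (C x * E * F) (C y * E' * G)) =
      hCoeff 0 (C (HahnSeries.single n (1 : ℂ)) * outer E E' * outer F G) := by
  rw [res_eq_hCoeff, hCoeff_eq_hCoeff_zero, outer_mul, outer_mul, outer_C, ← h, map_mul C (_ * _) (x * y),
    map_mul C _ (z a)⁻¹]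
  simp only [mul_assoc]

theorem outer_ofFun (f g : Fun) : outer (ofFun f) (ofFun g) =
    mapC (rename (Function.Embedding.inl : Time ↪ Time ⊕ Time) f *
      rename (Function.Embedding.inr : Time ↪ Time ⊕ Time) g) := by
  rw [outer, ofFun, map_mul, mapC, rename_map, rename_map]

/-- Multiplication of the bilinear equation for wave functions by `τ_m(t) τ_{m'}(t')`. -/
theorem mul_res_outer_waves (a : Fin 2) {f g : Fun} (hf : constantCoeff f ≠ 0)
    (hg : constantCoeff g ≠ 0) (x y u : K) (h : (z a)⁻¹ * (x * y) = u) (E E' S S' : Wave) :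
    (rename (Function.Embedding.inl : Time ↪ Time ⊕ Time) f *
      rename (Function.Embedding.inr : Time ↪ Time ⊕ Time) g) *
      res a (C (z a)⁻¹ * outer (C x * E * (S * (ofFun f)⁻¹)) (C y * E' * (S' * (ofFun g)⁻¹))) =
    res a (C u * outer E E' * outer S S') := by
  rw [res_eq_hCoeff, res_eq_hCoeff, ← hCoeff_mapC_mul, ← outer_ofFun]
  have c : ∀ {f : Fun}, constantCoeff f ≠ 0 → ofFun f * (ofFun f)⁻¹ = 1 := fun {f} hf =>
    MvPowerSeries.mul_inv_cancel _ (by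
      rw [ofFun, constantCoeff_map]
      exact (map_ne_zero_iff _ HahnSeries.C_injective).2 hf)
  have h1 : outer (ofFun f) (ofFun g) * outer (ofFun f)⁻¹ (ofFun g)⁻¹ = 1 := by
    rw [← outer_mul, c hf, c hg, ← map_one C, outer_C, mul_one, map_one]
  refine congrArg (hCoeff _) ?_
  rw [outer_mul, outer_mul, outer_mul, outer_C, ← h, map_mul C (z a)⁻¹]
  generalize outer (ofFun f) (ofFun g) = A at h1 ⊢
  generalize outer (ofFun f)⁻¹ (ofFun g)⁻¹ = B at h1 ⊢
  linear_combination (C (z a)⁻¹ * C (x * y) * outer E E' * outer S S') * h1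

end Waves

end TwoDKP

end

/-! ### Existence of the tau function -/

theorem mainTheorem3
    (Ψ₁ Ψ₂ Ψt₁ Ψt₂ : ℤ × ℤ → TwoDKP.Wave)
    (hΨ₁ : TwoDKP.IsWave₁ Ψ₁) (hΨ₂ : TwoDKP.IsWave₂ Ψ₂)
    (hΨt₁ : TwoDKP.IsAdjointWave₁ Ψt₁) (hΨt₂ : TwoDKP.IsAdjointWave₂ Ψt₂)
    (hbil : TwoDKP.WaveBilinear Ψ₁ Ψ₂ Ψt₁ Ψt₂) :
    ∃ τ : ℤ × ℤ → TwoDKP.Fun,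
      (∀ m, IsUnit (τ m)) ∧ TwoDKP.TauBilinear τ ∧
      (∀ m, Ψ₁ m = MvPowerSeries.C (TwoDKP.z 0 ^ m.1) * TwoDKP.expW (TwoDKP.phase 0) *
        (TwoDKP.shift (-1) 0 (τ m) * (TwoDKP.ofFun (τ m))⁻¹)) ∧
      (∀ m, Ψt₁ m = MvPowerSeries.C (TwoDKP.z 0 ^ (-m.1 + 1)) *
        TwoDKP.expW (-TwoDKP.phase 0) *
        (TwoDKP.shift 1 0 (τ m) * (TwoDKP.ofFun (τ m))⁻¹)) ∧
      (∀ m, Ψ₂ m = MvPowerSeries.C (TwoDKP.z 1 ^ m.2) * TwoDKP.expW (TwoDKP.phase 1) *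
        (TwoDKP.shift (-1) 1 (τ (m + (1, 1))) * (TwoDKP.ofFun (τ m))⁻¹)) ∧
      (∀ m, Ψt₂ m = MvPowerSeries.C (TwoDKP.z 1 ^ (-m.2 + 1)) *
        TwoDKP.expW (-TwoDKP.phase 1) *
        (TwoDKP.shift 1 1 (τ (m - (1, 1))) * (TwoDKP.ofFun (τ m))⁻¹)) := by
  open TwoDKP in
  obtain ⟨c₁, hc₁, h₁⟩ := hΨ₁
  obtain ⟨c₂, h₂⟩ := hΨ₂
  obtain ⟨ct₁, hct₁, ht₁⟩ := hΨt₁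
  obtain ⟨ct₂, ht₂⟩ := hΨt₂
  let P : Fin 2 → ℤ × ℤ → MvPowerSeries (Option Time) ℂ :=
    ![fun m => ofCoeffs (c₁ m), fun m => ofCoeffs (c₂ m)]
  let Q : Fin 2 → ℤ × ℤ → MvPowerSeries (Option Time) ℂ :=
    ![fun m => ofCoeffs (ct₁ m), fun m => ofCoeffs (ct₂ m)]
  have z0 : z 0 = HahnSeries.single (-1 : ℤ) (1 : ℂ) := by simpa using z_zero_zpow 1
  have z1 : z 1 = HahnSeries.single (1 : ℤ) (1 : ℂ) := by simpa using z_one_zpow 1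
  have hPQ : IsBilinear P Q := by
    intro m m' hm
    have h := hbil m m' hm
    rw [h₁, ht₁, h₂, ht₂, res_outer_waves 0 _ _ (m'.1 - m.1 - 1),
      res_outer_waves 1 _ _ (m.2 - m'.2 + 1)] at h
    · simp only [P, Q, Matrix.cons_val_zero, Matrix.cons_val_one, col_ofCoeffs]
      exact h
    · rw [z_one_zpow, z_one_zpow, z1, HahnSeries.inv_single, inv_one,
        HahnSeries.single_mul_single, HahnSeries.single_mul_single, HahnSeries.single_mul_single]
      congr 1
      · simp only [Fin.isValue, one_ne_zero, if_false]
        exact congrArg _ (by omega)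
      · norm_num
    · rw [z_zero_zpow, z_zero_zpow, z0, HahnSeries.inv_single, inv_one,
        HahnSeries.single_mul_single, HahnSeries.single_mul_single, HahnSeries.single_mul_single]
      congr 1
      · simp only [Fin.isValue, if_true]
        exact congrArg _ (by omega)
      · norm_num
  obtain ⟨τ, hτ0, hP, hQ⟩ := hPQ.exists_tau
    (fun m => X_none_dvd_sub_one ((wCoeff_ofCoeffs _ 0).trans (hc₁ m)))
    (fun m => X_none_dvd_sub_one ((wCoeff_ofCoeffs _ 0).trans (hct₁ m)))
  have hdiv : ∀ (m : ℤ × ℤ) {F G : MvPowerSeries (Option Time) ℂ}, F * inc (τ m) = G →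
      col F = col G * (ofFun (τ m))⁻¹ := by
    intro m F G h
    rw [MvPowerSeries.eq_mul_inv_iff_mul_eq, ← h, map_mul, col_inc]
    · rfl
    · rw [ofFun, MvPowerSeries.constantCoeff_map]
      exact (map_ne_zero_iff _ HahnSeries.C_injective).2 (hτ0 m)
  have f₁ : ∀ m, Ψ₁ m = MvPowerSeries.C (z 0 ^ m.1) * expW (phase 0) *
      (shift (-1) 0 (τ m) * (ofFun (τ m))⁻¹) := by
    intro m
    have h := hdiv m (hP 0 m)
    rw [show latticeShift 0 = 0 from rfl, add_zero] at h
    rw [shift_eq_col, ← h, h₁, ← col_ofCoeffs]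
    rfl
  have ft₁ : ∀ m, Ψt₁ m = MvPowerSeries.C (z 0 ^ (-m.1 + 1)) * expW (-phase 0) *
      (shift 1 0 (τ m) * (ofFun (τ m))⁻¹) := by
    intro m
    have h := hdiv m (hQ 0 m)
    rw [show latticeShift 0 = 0 from rfl, sub_zero] at h
    rw [shift_eq_col, ← h, ht₁, ← col_ofCoeffs]
    rfl
  have f₂ : ∀ m, Ψ₂ m = MvPowerSeries.C (z 1 ^ m.2) * expW (phase 1) *
      (shift (-1) 1 (τ (m + (1, 1))) * (ofFun (τ m))⁻¹) := by
    intro m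
    have h := hdiv m (hP 1 m)
    rw [show latticeShift 1 = (1, 1) from rfl] at h
    rw [shift_eq_col, ← h, h₂, ← col_ofCoeffs]
    rfl
  have ft₂ : ∀ m, Ψt₂ m = MvPowerSeries.C (z 1 ^ (-m.2 + 1)) * expW (-phase 1) *
      (shift 1 1 (τ (m - (1, 1))) * (ofFun (τ m))⁻¹) := by
    intro m
    have h := hdiv m (hQ 1 m)
    rw [show latticeShift 1 = (1, 1) from rfl] at h
    rw [shift_eq_col, ← h, ht₂, ← col_ofCoeffs]
    rfl
  refine ⟨τ, fun m => ?_, fun m m' hm => ?_, f₁, ft₁, f₂, ft₂⟩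
  · rw [MvPowerSeries.isUnit_iff_constantCoeff]
    exact (hτ0 m).isUnit
  -- The factor τ_m(t) τ_{m'}(t') is free of z, so it passes under both residues and cancels the
  -- denominators.
  · have h := hbil m m' hm
    rw [f₁, ft₁, f₂, ft₂] at h
    have h3 := congrArg (fun R => (MvPowerSeries.rename
      (Function.Embedding.inl : Time ↪ Time ⊕ Time) (τ m) * MvPowerSeries.rename
      (Function.Embedding.inr : Time ↪ Time ⊕ Time) (τ m')) * R) h
    beta_reduce at h3
    rwa [mul_res_outer_waves 0 (hτ0 m) (hτ0 m') _ _ (z 0 ^ (m.1 - m'.1)),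
      mul_res_outer_waves 1 (hτ0 m) (hτ0 m') _ _ (z 1 ^ (m.2 - m'.2))] at h3
    · rw [z_one_zpow, z_one_zpow, z_one_zpow, z1, HahnSeries.inv_single, inv_one,
        HahnSeries.single_mul_single, HahnSeries.single_mul_single]
      congr 1
      · exact congrArg _ (by omega)
      · norm_num
    · rw [z_zero_zpow, z_zero_zpow, z_zero_zpow, z0, HahnSeries.inv_single, inv_one,
        HahnSeries.single_mul_single, HahnSeries.single_mul_single]
      congr 1
      · exact congrArg _ (by omega)
      · norm_num
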